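/- **Setting.** There are finitely many variables $X_1,\dots,X_n$; variable $i$ takes values in a finite set and, independently of the others, equals $j$ with probability $p_{i,j}$, where $\sum_j p_{i,j}=1$. Let $\mathcal X$ be the set of all pairs $(i,j)$ with $j$ a value of variable $i$, and put $p^Y=\prod_{(i,j)\in Y}p_{i,j}$ for $Y\subseteq\mathcal X$. An atomic event is a set $B\subseteq\mathcal X$ that does not contain two different values of the same variable; it is true if $X_i=j$ for all $(i,j)\in B$. Let $\mathcal B$ be a set of atomic events (the bad events), let $\mathcal L:\mathcal B\to[K]$ be a labelling, and let $\mathcal B_k=\{B\in\mathcal B:\mathcal L(B)=k\}$. For each $k\in[K]$ let $Q_k:2^{\mathcal X}\to[0,1]$ be a fractional hitting set for $\mathcal B_k$, i.e. $\sum_{Y\subseteq B}Q_k(Y)\ge 1$ for all $B\in\mathcal B_k$. A pair $(Y,k)$ is supported if $Q_k(Y)>0$. **Partial Resampling Algorithm (PRA).** Draw all variables independently according to $p$. As long as some bad event is true, select an arbitrary true bad event $B$ (by any rule, possibly randomized and depending on the whole history so far); with $k=\mathcal L(B)$, select one subset $Y\subseteq B$, where a given $Y$ is selected with probability $Q_k(Y)/\sum_{Y'\subseteq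 B}Q_k(Y')$; and resample all variables involved in $Y$ independently according to $p$. **Relations.** For $Y,Z\subseteq\mathcal X$ write $Y\sim Z$ if some variable is involved in both, and $Y\bowtie_k Z$ if $Y\not\sim Z$ and $Y,Z\subseteq B$ for some $B\in\mathcal B_k$. Write $(Y,k)\approx(Z,l)$ if $Y\sim Z$, or $k=l$ and $Y\bowtie_k Z$. A neighbor-set for $(Y,k)$ is a set $\mathcal T\subseteq 2^{\mathcal X}\times[K]$ such that every member of $\mathcal T$ is $\approx(Y,k)$; no two distinct members $(Z,l),(Z',l')$ of $\mathcal T$ satisfy $Z\sim Z'$; and at most one member of the form $(Z,k)$ satisfies $Z\bowtie_k Y$. **Theorem.** In each of the following three cases, whatever the selection rule for the true bad event, the PRA terminates with probability one in a configuration avoiding all bad events, and the expected number of resamplings is bounded as stated. (a) There is $\mu:2^{\mathcal X}\times[K]\to[0,\infty)$ such that for all $Y\subseteq\mathcal X$ and $k\in[K]$ $$\mu(Y,k)\ \ge\ p^Y Q_k(Y)\sum_{\mathcal T\text{ a neighbor-set for }(Y,k)}\ \prod_{(Y',k')\in\mathcal T}\mu(Y',k').$$ Then the expected number of resamplings is at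 most $\sum_{(Y,k)}\mu(Y,k)$. (b) There is $\mu:2^{\mathcal X}\times[K]\to[0,\infty)$ such that for all $Y\subseteq\mathcal X$ and $k\in[K]$ $$\mu(Y,k)\ \ge\ p^Y Q_k(Y)\Bigl(\prod_{Y'\sim Y}\bigl(1+\sum_{k'\in[K]}\mu(Y',k')\bigr)\Bigr)\Bigl(1+\sum_{Y''\bowtie_k Y}\mu(Y'',k)\Bigr).$$ Then the expected number of resamplings is at most $\sum_{(Y,k)}\mu(Y,k)$. (c) There are a real number $P$ and a natural number $D$ with $ePD\le 1$ such that $p^YQ_k(Y)\le P$ for all $Y\subseteq\mathcal X$ and $k\in[K]$, and for every supported $(Y,k)$ there are at most $D$ supported pairs $(Y',k')$ with $(Y',k')\approx(Y,k)$ ($(Y',k')=(Y,k)$ is allowed). Then the expected number of resamplings is at most $e\sum_{(Y,k)}p^YQ_k(Y)$. -/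

import Mathlib

open MeasureTheory ProbabilityTheory
open scoped ENNReal

/-! Variables are indexed by `Fin n`; variable `i` takes values in the finite type `V i`.
An element is a pair `(i, j)` with `j : V i`, that is, a term of `Σ i, V i`. -/

namespace PartialResampling

variable {n K : ℕ} {V : Fin n → Type*}

/-- Atomic event: no two different values of the same variable. -/
def IsAtomic (B : Finset (Σ i, V i)) : Prop :=
  ∀ e ∈ B, ∀ e' ∈ B, e.1 = e'.1 → e = e'

/-- The conjunction `⋀_{(i,j) ∈ B} X_i = j` is true in the configuration `x`. -/
def Holds (B : Finset (Σ i, V i)) (x : ∀ i, V i) : Prop :=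
  ∀ e ∈ B, x e.1 = e.2

/-- A collection of atomic bad events, each with a label in `[K]`. -/
structure BadEvents (V : Fin n → Type*) (K : ℕ) where
  events : Finset (Finset (Σ i, V i))
  atomic : ∀ B ∈ events, IsAtomic B
  label : {B // B ∈ events} → Fin K

/-- `𝓑_k`: the bad events with label `k`. -/
def BadEvents.family (𝓑 : BadEvents V K) (k : Fin K) : Set (Finset (Σ i, V i)) :=
  {B | ∃ hB : B ∈ 𝓑.events, 𝓑.label ⟨B, hB⟩ = k}

/-- `C : 2^𝓧 → [0,1]` is a fractional hitting set for the family `S`. -/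
def IsFractionalHittingSet (C : Finset (Σ i, V i) → ℝ) (S : Set (Finset (Σ i, V i))) : Prop :=
  (∀ Y, C Y ∈ Set.Icc (0 : ℝ) 1) ∧ ∀ B ∈ S, 1 ≤ ∑ Y ∈ B.powerset, C Y

/-! ### The relations -/

/-- `Y ∼ Z`: the sets involve a common variable. -/
def Overlap (Y Z : Finset (Σ i, V i)) : Prop :=
  ∃ e ∈ Y, ∃ e' ∈ Z, e.1 = e'.1

/-- `Y ⋈_k Z`. -/
def Bowtie (𝓑 : BadEvents V K) (k : Fin K) (Y Z : Finset (Σ i, V i)) : Prop :=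
  ¬ Overlap Y Z ∧ ∃ B ∈ 𝓑.family k, Y ⊆ B ∧ Z ⊆ B

/-- `(Y,k) ≈ (Z,l)`: either `Y ∼ Z`, or `k = l` and `Y ⋈_k Z`. -/
def Related (𝓑 : BadEvents V K) (a b : Finset (Σ i, V i) × Fin K) : Prop :=
  Overlap a.1 b.1 ∨ (a.2 = b.2 ∧ Bowtie 𝓑 a.2 a.1 b.1)

/-- `T` is a neighbor-set for `a = (Y,k)`. -/
def IsNeighborSet (𝓑 : BadEvents V K) (a : Finset (Σ i, V i) × Fin K)
    (T : Finset (Finset (Σ i, V i) × Fin K)) : Prop :=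
  (∀ b ∈ T, Related 𝓑 b a) ∧
  (∀ b ∈ T, ∀ c ∈ T, b ≠ c → ¬ Overlap b.1 c.1) ∧
  (∀ b ∈ T, ∀ c ∈ T, b.2 = a.2 → c.2 = a.2 →
    Bowtie 𝓑 a.2 b.1 a.1 → Bowtie 𝓑 a.2 c.1 a.1 → b = c)

section Weights

variable [∀ i, Fintype (V i)]

/-- `p^Y = ∏_{(i,j) ∈ Y} p_{i,j}`. -/
noncomputable def weight (p : ∀ i, PMF (V i)) (Y : Finset (Σ i, V i)) : ℝ :=
  ∏ e ∈ Y, (p e.1 e.2).toReal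

open Classical in
/-- The finite collection of all neighbor-sets for `a`. -/
noncomputable def neighborSets (𝓑 : BadEvents V K) (a : Finset (Σ i, V i) × Fin K) :
    Finset (Finset (Finset (Σ i, V i) × Fin K)) :=
  Finset.univ.filter fun T => IsNeighborSet 𝓑 a T

open Classical in
/-- All `Z` with `Z ∼ Y`. -/
noncomputable def overlapping (Y : Finset (Σ i, V i)) : Finset (Finset (Σ i, V i)) :=
  Finset.univ.filter fun Z => Overlap Z Y

open Classical in
/-- All `Z` with `Z ⋈_k Y`. -/
noncomputable def bowtieSets (𝓑 : BadEvents V K) (k : Fin K) (Y : Finset (Σ i, V i)) :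
    Finset (Finset (Σ i, V i)) :=
  Finset.univ.filter fun Z => Bowtie 𝓑 k Z Y

open Classical in
/-- All supported `b` with `b ≈ a`. -/
noncomputable def supportedNeighbors (𝓑 : BadEvents V K) (Q : Fin K → Finset (Σ i, V i) → ℝ)
    (a : Finset (Σ i, V i) × Fin K) : Finset (Finset (Σ i, V i) × Fin K) :=
  Finset.univ.filter fun b => 0 < Q b.2 b.1 ∧ Related 𝓑 b a

end Weights

/-! ### The Partial Resampling Algorithm as a stochastic process

The selection of the violated set in each round is left to an arbitrary strategy, which sees the
complete history of the run so far and may randomize. -/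

/-- What is recorded after each round: the current configuration and, if the round performed a
resampling, the violated set and the resampled set. -/
structure Record (V : Fin n → Type*) where
  config : ∀ i, V i
  resampling : Option (Finset (Σ i, V i) × Finset (Σ i, V i))

instance : MeasurableSpace (Record V) := ⊤

instance : DiscreteMeasurableSpace (Record V) := ⟨fun _ => trivial⟩

instance [∀ i, Fintype (V i)] : Countable (Record V) :=
  Function.Injective.countable (f := fun r : Record V => (r.config, r.resampling)) <| by
    rintro ⟨x, m⟩ ⟨y, m'⟩ h
    simpa using h

/-- The records of rounds `0, …, t`. -/
abbrev History (V : Fin n → Type*) (t : ℕ) : Type _ :=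
  Finset.Iic t → Record V

/-- The configuration after the last round of a history. -/
def History.current {t : ℕ} (h : History V t) : ∀ i, V i :=
  (h ⟨t, Finset.mem_Iic.2 le_rfl⟩).config

/-- The bad events that are true in the configuration `x`. -/
abbrev TrueBad (𝓑 : BadEvents V K) (x : ∀ i, V i) : Type _ :=
  {B : {B // B ∈ 𝓑.events} // Holds B.1 x}

/-- A rule that selects, after every history with some true bad event, a (possibly random) true
bad event. -/
def Strategy (𝓑 : BadEvents V K) : Type _ :=
  ∀ (t : ℕ) (h : History V t), Nonempty (TrueBad 𝓑 h.current) → PMF (TrueBad 𝓑 h.current)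

section Algorithm

variable [∀ i, Fintype (V i)]

/-- All variables drawn independently, variable `i` from `p i`. -/
noncomputable def sampleAll (p : ∀ i, PMF (V i)) : PMF (∀ i, V i) :=
  PMF.ofFintype (fun x => ∏ i, p i (x i)) <| by
    classical
    rw [← Fintype.piFinset_univ, ← Finset.prod_univ_sum]
    refine Finset.prod_eq_one fun i _ => ?_
    have h := (p i).tsum_coe
    rwa [tsum_fintype] at h

open Classical in
/-- The variables involved in `Y` are drawn anew, independently; the others are kept. -/
noncomputable def resample (p : ∀ i, PMF (V i)) (Y : Finset (Σ i, V i)) (x : ∀ i, V i) :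
    PMF (∀ i, V i) :=
  (sampleAll p).map fun z i => if ∃ e ∈ Y, e.1 = i then z i else x i

open Classical in
/-- For a bad event `B` with label `k`: the random set `Y ⊆ B` with
`P(Y) = Q_k(Y) / ∑_{Y' ⊆ B} Q_k(Y')`. -/
noncomputable def selectSubset (𝓑 : BadEvents V K) (Q : Fin K → Finset (Σ i, V i) → ℝ)
    (hQ : ∀ k, IsFractionalHittingSet (Q k) (𝓑.family k)) (B : {B // B ∈ 𝓑.events}) :
    PMF (Finset (Σ i, V i)) :=
  PMF.normalize (fun Y => if Y ⊆ B.1 then ENNReal.ofReal (Q (𝓑.label B) Y) else 0)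
    (by
      have h := (hQ (𝓑.label B)).2 B.1 ⟨B.2, rfl⟩
      have hpos : 0 < ∑ Y ∈ B.1.powerset, Q (𝓑.label B) Y := lt_of_lt_of_le one_pos h
      obtain ⟨Y, hY, hlt⟩ := Finset.exists_lt_of_sum_lt
        (f := fun _ => (0 : ℝ)) (by simpa using hpos)
      intro h0
      have := ENNReal.tsum_eq_zero.1 h0 Y
      rw [if_pos (Finset.mem_powerset.1 hY), ENNReal.ofReal_eq_zero] at this
      exact absurd hlt (not_lt.2 this))
    (by
      rw [tsum_fintype]
      refine ENNReal.sum_ne_top.2 fun Y _ => ?_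
      split_ifs
      · exact ENNReal.ofReal_ne_top
      · exact ENNReal.zero_ne_top)

open Classical in
/-- One round: if some bad event is true, the strategy selects a true bad event `B`, a random
`Y ⊆ B` is selected and its variables are resampled; otherwise the algorithm has ended and the
configuration stays as it is. -/
noncomputable def round (𝓑 : BadEvents V K) (p : ∀ i, PMF (V i))
    (Q : Fin K → Finset (Σ i, V i) → ℝ)
    (hQ : ∀ k, IsFractionalHittingSet (Q k) (𝓑.family k)) (σ : Strategy 𝓑)
    {t : ℕ} (h : History V t) : PMF (Record V) :=
  if hB : Nonempty (TrueBad 𝓑 h.current) then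
    (σ t h hB).bind fun B =>
      (selectSubset 𝓑 Q hQ B.1).bind fun Y =>
        (resample p Y h.current).map fun x => ⟨x, some (B.1.1, Y)⟩
  else
    PMF.pure ⟨h.current, none⟩

/-- The transition kernel from histories to the next record. -/
noncomputable def roundKernel (𝓑 : BadEvents V K) (p : ∀ i, PMF (V i))
    (Q : Fin K → Finset (Σ i, V i) → ℝ)
    (hQ : ∀ k, IsFractionalHittingSet (Q k) (𝓑.family k)) (σ : Strategy 𝓑) (t : ℕ) :
    Kernel (History V t) (Record V) :=
  Kernel.ofFunOfCountable fun h => (round 𝓑 p Q hQ σ h).toMeasure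

instance (𝓑 : BadEvents V K) (p : ∀ i, PMF (V i)) (Q : Fin K → Finset (Σ i, V i) → ℝ)
    (hQ : ∀ k, IsFractionalHittingSet (Q k) (𝓑.family k)) (σ : Strategy 𝓑) (t : ℕ) :
    IsMarkovKernel (roundKernel 𝓑 p Q hQ σ t) :=
  ⟨fun h => inferInstanceAs (IsProbabilityMeasure (round 𝓑 p Q hQ σ h).toMeasure)⟩

/-- The law of the initial record: a fresh sample of all variables. -/
noncomputable def initialLaw (p : ∀ i, PMF (V i)) : Measure (Record V) :=
  ((sampleAll p).map fun x => (⟨x, none⟩ : Record V)).toMeasure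

instance (p : ∀ i, PMF (V i)) : IsProbabilityMeasure (initialLaw p) :=
  inferInstanceAs (IsProbabilityMeasure (PMF.toMeasure _))

/-- The law of the whole run of the algorithm. -/
noncomputable def runLaw (𝓑 : BadEvents V K) (p : ∀ i, PMF (V i))
    (Q : Fin K → Finset (Σ i, V i) → ℝ)
    (hQ : ∀ k, IsFractionalHittingSet (Q k) (𝓑.family k)) (σ : Strategy 𝓑) :
    Measure (ℕ → Record V) :=
  Kernel.trajMeasure (X := fun _ => Record V) (initialLaw p) (roundKernel 𝓑 p Q hQ σ)

end Algorithm

/-- The run ends, and its final configuration avoids all bad events. -/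
def TerminatesFeasibly (𝓑 : BadEvents V K) (ω : ℕ → Record V) : Prop :=
  ∃ x : ∀ i, V i, (∀ B ∈ 𝓑.events, ¬ Holds B x) ∧
    ∃ t, ∀ s, t ≤ s → (ω s).config = x ∧ (ω (s + 1)).resampling = none

/-- The total number of resamplings in a run. -/
noncomputable def numResamplings (ω : ℕ → Record V) : ℝ≥0∞ :=
  ∑' t, if (ω t).resampling.isSome then 1 else 0

end PartialResampling

/-! The proof counts witness trees. Fix a resampling and read the run backwards from it. The
resampled piece is the root. Each earlier piece is attached by `succ` to a deepest node that it
overlaps, or that has the same label, lies with it in one bad event, and has no such child yet.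
Pieces with no such node are ignored. Each resampling yields exactly one nonempty tree, so the
expected number of resamplings is the sum over trees τ of the expected number of occurrences of τ.

This expectation is at most the product of p^Y Q_k(Y) over the nodes of τ. Given the current
configuration, the deepest occurrence of a variable in τ must agree with its current value, while
all other occurrences refer to values still to be drawn; `checkWeight` is the resulting conditional
bound. It does not increase in expectation in a round (`tsum_round_le`), whatever true bad event B
is picked. If adding some Y ⊆ B can produce τ, then Y and the previous tree are unique
(`Added.unique`; the ⋈-children serve this purpose), and Q_k(Y) bounds the probability of selecting
Y. Otherwise only skipped pieces lead to τ, and their variables are not tested. Induction on the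
number of rounds (`lintegral_count_le`) and averaging over the initial sample give the bound.

The children of a node form a neighbor-set. Cut the trees at depth h and charge μ for each node at
that depth: by the hypothesis of (a) the total does not increase with h, and for h = 0 it is at most
1 + ∑ μ, the 1 belonging to the empty tree (`tsum_witness_le`). A finite expectation forces
termination. The hypothesis of (b) implies that of (a) for the same μ, and (c) reduces to (a) with μ
= e p^Y Q_k(Y). -/

namespace PartialResampling

/-! ### Witness trees and their growth backwards in time -/

section WitnessTrees

variable {n K : ℕ} {V : Fin n → Type*}

/-- The labels `(Y, k)` for which `Y` is contained in a bad event with label `k`. -/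
abbrev Piece (𝓑 : BadEvents V K) : Type _ :=
  {a : Finset (Σ i, V i) × Fin K // ∃ B ∈ 𝓑.family a.2, a.1 ⊆ B}

/-- A node of a witness tree: its label, and the labels of its ancestors, nearest first. -/
abbrev Node (𝓑 : BadEvents V K) : Type _ := Piece 𝓑 × List (Piece 𝓑)

/-- `b ⋈ a`, and both have the same second component. -/
def Side {𝓑 : BadEvents V K} (b a : Piece 𝓑) : Prop :=
  b.1.2 = a.1.2 ∧ Bowtie 𝓑 a.1.2 b.1.1 a.1.1

/-- Witness trees, as sets of nodes. The empty tree is included. -/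
structure IsWitness {𝓑 : BadEvents V K} (τ : Finset (Node 𝓑)) : Prop where
  closed : ∀ e f u, (e, f :: u) ∈ τ → (f, u) ∈ τ
  root : ∀ e f, (e, []) ∈ τ → (f, []) ∈ τ → e = f
  indep : ∀ a ∈ τ, ∀ b ∈ τ, a.2.length = b.2.length → Overlap a.1.1.1 b.1.1.1 → a = b
  related : ∀ e f u, (e, f :: u) ∈ τ → Related 𝓑 e.1 f.1
  side : ∀ e₁ e₂ f u, (e₁, f :: u) ∈ τ → (e₂, f :: u) ∈ τ → Side e₁ f → Side e₂ f → e₁ = e₂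

/-- A node with label `e` may be attached to `a`. -/
def Eligible {𝓑 : BadEvents V K} (τ : Finset (Node 𝓑)) (e : Piece 𝓑) (a : Node 𝓑) : Prop :=
  Overlap e.1.1 a.1.1.1 ∨ (Side e a.1 ∧ ∀ c, (c, a.1 :: a.2) ∈ τ → ¬ Side c a.1)

/-- `a` is a deepest node of `τ` to which a node with label `e` may be attached. -/
def Attach {𝓑 : BadEvents V K} (τ : Finset (Node 𝓑)) (e : Piece 𝓑) (a : Node 𝓑) : Prop :=
  a ∈ τ ∧ Eligible τ e a ∧ ∀ b ∈ τ, Eligible τ e b → b.2.length ≤ a.2.length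

open Classical in
/-- The witness tree after an earlier event `e` is taken into account. -/
noncomputable def succ {𝓑 : BadEvents V K} (e : Piece 𝓑) (τ : Finset (Node 𝓑)) :
    Finset (Node 𝓑) :=
  if τ = ∅ then {(e, [])}
  -- Ties between deepest nodes are broken by choice; nothing later depends on how.
  else if h : ∃ a, Attach τ e a then insert (e, h.choose.1 :: h.choose.2) τ else τ

/-- `τ'` arises from `τ` by adding a node with label `e` at address `u`. -/
structure Added {𝓑 : BadEvents V K} (e : Piece 𝓑) (u : List (Piece 𝓑))
    (τ τ' : Finset (Node 𝓑)) : Prop where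
  not_mem : (e, u) ∉ τ
  mem_iff : ∀ a, a ∈ τ' ↔ a = (e, u) ∨ a ∈ τ
  deep : ∀ b ∈ τ, Eligible τ e b → b.2.length < u.length
  leaf : ∀ c, (c, e :: u) ∉ τ'

variable {𝓑 : BadEvents V K}

lemma Overlap.symm {Y Z : Finset (Σ i, V i)} (h : Overlap Y Z) : Overlap Z Y := by
  obtain ⟨e, he, f, hf, h⟩ := h
  exact ⟨f, hf, e, he, h.symm⟩

lemma Overlap.self_left {Y Z : Finset (Σ i, V i)} (h : Overlap Y Z) : Overlap Y Y := by
  obtain ⟨e, he, f, hf, h⟩ := h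
  exact ⟨e, he, e, he, rfl⟩

lemma Eligible.related {τ : Finset (Node 𝓑)} {e : Piece 𝓑} {a : Node 𝓑}
    (h : Eligible τ e a) : Related 𝓑 e.1 a.1.1 := by
  rcases h with h | ⟨⟨h1, h2⟩, -⟩
  · exact Or.inl h
  · exact Or.inr ⟨h1, h1 ▸ h2⟩

lemma isWitness_empty : IsWitness (∅ : Finset (Node 𝓑)) := by
  constructor <;> simp

lemma succ_ne_empty (e : Piece 𝓑) (τ : Finset (Node 𝓑)) : succ e τ ≠ ∅ := by
  unfold succ
  split_ifs with h1 h2 <;> simp [h1]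

lemma exists_attach {τ : Finset (Node 𝓑)} {e : Piece 𝓑} {b : Node 𝓑} (hb : b ∈ τ)
    (h : Eligible τ e b) : ∃ a, Attach τ e a := by
  classical
  obtain ⟨a, ha, hmax⟩ := (τ.filter (Eligible τ e)).exists_max_image (fun a => a.2.length)
    ⟨b, Finset.mem_filter.2 ⟨hb, h⟩⟩
  rw [Finset.mem_filter] at ha
  exact ⟨a, ha.1, ha.2, fun c hc hce => hmax c (Finset.mem_filter.2 ⟨hc, hce⟩)⟩

/-- If the place were taken, an overlapping piece would overlap its own copy there and be attached
deeper, and a side piece would find the side place occupied. Hence the set of nodes really grows. -/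
lemma Attach.not_mem {τ : Finset (Node 𝓑)} {e : Piece 𝓑} {a : Node 𝓑}
    (h : Attach τ e a) : (e, a.1 :: a.2) ∉ τ := by
  intro hm
  rcases h.2.1 with ho | ⟨hs, hc⟩
  · have := h.2.2 _ hm (Or.inl ho.self_left)
    simp at this
  · exact hc _ hm hs

/-- A piece either makes the tree grow by a node, or is unrelated to the tree. -/
lemma succ_cases {τ : Finset (Node 𝓑)} (hτ : IsWitness τ) (e : Piece 𝓑) :
    (∃ u, Added e u τ (succ e τ)) ∨ (succ e τ = τ ∧ ∀ a ∈ τ, ¬ Eligible τ e a) := by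
  classical
  unfold succ
  split_ifs with h1 h2
  · left
    subst h1
    exact ⟨[], by simp, by simp, by simp, by simp⟩
  · left
    have ha := h2.choose_spec
    set a := h2.choose
    refine ⟨a.1 :: a.2, ha.not_mem, by simp, fun b hb hbe => ?_, fun c hc => ?_⟩
    · simpa using Nat.lt_succ_of_le (ha.2.2 b hb hbe)
    · rw [Finset.mem_insert] at hc
      rcases hc with hc | hc
      · have := congrArg (fun z : Node 𝓑 => z.2.length) hc
        simp at this
      · exact ha.not_mem (hτ.closed _ _ _ hc)
  · right
    exact ⟨rfl, fun a ha h => h2 (exists_attach ha h)⟩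

/-- Maximal depth gives `indep`: a node at the new depth that overlaps `e` would have been a deeper
place to attach. `Eligible` admits a side child only where there is none, which gives `side`. -/
lemma isWitness_succ {τ : Finset (Node 𝓑)} (hτ : IsWitness τ) (e : Piece 𝓑) :
    IsWitness (succ e τ) := by
  classical
  unfold succ
  split_ifs with h1 h2
  · constructor <;> simp
  · have ha := h2.choose_spec
    set a := h2.choose
    constructor
    · intro e' f u h
      rw [Finset.mem_insert] at h ⊢
      right
      rcases h with h | h
      · obtain ⟨rfl, h⟩ := Prod.mk.inj h
        obtain ⟨rfl, rfl⟩ := List.cons.inj h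
        exact ha.1
      · exact hτ.closed _ _ _ h
    · intro e' f he hf
      simp only [Finset.mem_insert, Prod.mk.injEq, reduceCtorEq, and_false, false_or] at he hf
      exact hτ.root _ _ he hf
    · have key : ∀ b ∈ τ, b.2.length = a.2.length + 1 → ¬ Overlap e.1.1 b.1.1.1 := by
        intro b hb hl ho
        have := ha.2.2 b hb (Or.inl ho)
        omega
      intro b hb c hc hl ho
      rw [Finset.mem_insert] at hb hc
      rcases hb with rfl | hb <;> rcases hc with rfl | hc
      · rfl
      · exact absurd ho (key c hc (by simpa using hl.symm))
      · exact absurd ho.symm (key b hb (by simpa using hl))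
      · exact hτ.indep b hb c hc hl ho
    · intro e' f u h
      rw [Finset.mem_insert] at h
      rcases h with h | h
      · obtain ⟨rfl, h⟩ := Prod.mk.inj h
        obtain ⟨rfl, rfl⟩ := List.cons.inj h
        exact ha.2.1.related
      · exact hτ.related _ _ _ h
    · have key : ∀ c, (c, a.1 :: a.2) ∈ τ → Side c a.1 → ¬ Side e a.1 := by
        intro c hc hs hs'
        rcases ha.2.1 with ho | ⟨-, h⟩
        · exact hs'.2.1 ho
        · exact h c hc hs
      intro c c' f u hc hc' hs hs'
      rw [Finset.mem_insert] at hc hc'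
      rcases hc with hc | hc <;> rcases hc' with hc' | hc'
      · rw [Prod.mk.injEq] at hc hc'
        rw [hc.1, hc'.1]
      · obtain ⟨rfl, h⟩ := Prod.mk.inj hc
        obtain ⟨rfl, rfl⟩ := List.cons.inj h
        exact absurd hs (key c' hc' hs')
      · obtain ⟨rfl, h⟩ := Prod.mk.inj hc'
        obtain ⟨rfl, rfl⟩ := List.cons.inj h
        exact absurd hs' (key c hc hs)
      · exact hτ.side c c' f u hc hc' hs hs'
  · exact hτ

/-- A leaf has no side child, so it accepts every piece of a common bad event with its label,
overlapping or not. -/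
lemma eligible_of_leaf {τ : Finset (Node 𝓑)} {e : Piece 𝓑} {a : Node 𝓑}
    (hleaf : ∀ c, (c, a.1 :: a.2) ∉ τ) (hk : e.1.2 = a.1.1.2)
    (hB : ∃ B ∈ 𝓑.family a.1.1.2, e.1.1 ⊆ B ∧ a.1.1.1 ⊆ B) : Eligible τ e a := by
  by_cases h : Overlap e.1.1 a.1.1.1
  · exact Or.inl h
  · exact Or.inr ⟨⟨hk, h, hB⟩, fun c hc => absurd hc (hleaf c)⟩

/-- Among the subsets of one bad event, a piece whose addition produced the tree is unique, and
so is the tree that it was added to. -/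
lemma Added.unique {τ τ' τ₁ : Finset (Node 𝓑)} {e e' : Piece 𝓑} {u : List (Piece 𝓑)}
    (h : Added e u τ τ₁) (hτ' : IsWitness τ') (he' : succ e' τ' = τ₁) (hk : e'.1.2 = e.1.2)
    (hB : ∃ B ∈ 𝓑.family e.1.2, e'.1.1 ⊆ B ∧ e.1.1 ⊆ B) : e' = e ∧ τ' = τ := by
  rcases succ_cases hτ' e' with ⟨u', h'⟩ | ⟨h1, h2⟩
  · rw [he'] at h'
    by_cases hn : (e', u') = (e, u)
    · obtain ⟨rfl, rfl⟩ := Prod.mk.inj hn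
      refine ⟨rfl, Finset.ext fun a => ?_⟩
      have := (h.mem_iff a).symm.trans (h'.mem_iff a)
      constructor
      · intro ha
        rcases this.2 (Or.inr ha) with rfl | h3
        · exact absurd ha h'.not_mem
        · exact h3
      · intro ha
        rcases this.1 (Or.inr ha) with rfl | h3
        · exact absurd ha h.not_mem
        · exact h3
    -- Each of the two new nodes is a leaf already present before the other was added, so each would
    -- be strictly deeper than the other.
    · have m1 : (e, u) ∈ τ' := by
        have := (h'.mem_iff (e, u)).1 ((h.mem_iff _).2 (Or.inl rfl))
        exact this.resolve_left fun h => hn h.symm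
      have m2 : (e', u') ∈ τ := by
        have := (h.mem_iff (e', u')).1 ((h'.mem_iff _).2 (Or.inl rfl))
        exact this.resolve_left hn
      have l1 := h'.deep _ m1 (eligible_of_leaf
        (fun c hc => h.leaf c ((h'.mem_iff _).2 (Or.inr hc))) hk hB)
      obtain ⟨B, hB1, hB2, hB3⟩ := hB
      have l2 := h.deep _ m2 (eligible_of_leaf
        (fun c hc => h'.leaf c ((h.mem_iff _).2 (Or.inr hc))) hk.symm
          ⟨B, by rw [hk]; exact hB1, hB3, hB2⟩)
      simp only at l1 l2
      omega
  -- Skipping `e'` is impossible, since the leaf `(e, u)` accepts it.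
  · rw [he'] at h1
    subst h1
    exact absurd (eligible_of_leaf h.leaf hk hB) (h2 _ ((h.mem_iff _).2 (Or.inl rfl)))

end WitnessTrees

/-! ### The conditional weight of a tree under resampling -/

section Check

variable {n K : ℕ} {V : Fin n → Type*}

open Classical in
/-- The configuration that agrees with `z` on `S` and with `x` elsewhere. -/
noncomputable def mix (S : Set (Fin n)) (z x : ∀ i, V i) : ∀ i, V i :=
  fun i => if i ∈ S then z i else x i

open Classical in
/-- The indicator of the event that the variable of `e` has the value prescribed by `e`. -/
noncomputable def agree (x : ∀ i, V i) (e : Σ i, V i) : ℝ≥0∞ :=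
  if x e.1 = e.2 then 1 else 0

/-- The variables involved in `Y`. -/
def vars (Y : Finset (Σ i, V i)) : Set (Fin n) := {i | ∃ e ∈ Y, e.1 = i}

variable {𝓑 : BadEvents V K}

lemma Piece.atomic (a : Piece 𝓑) : IsAtomic a.1.1 := by
  obtain ⟨B, ⟨hB, -⟩, h⟩ := a.2
  exact fun e he f hf => 𝓑.atomic B hB e (h he) f (h hf)

/-- No node of `τ` deeper than `a` involves the variable `i`. -/
def Top (τ : Finset (Node 𝓑)) (a : Node 𝓑) (i : Fin n) : Prop :=
  ∀ b ∈ τ, i ∈ vars b.1.1.1 → b.2.length ≤ a.2.length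

/-- The weight `Q_k(Y)` of a piece `(Y, k)`. -/
noncomputable def hitWeight (Q : Fin K → Finset (Σ i, V i) → ℝ) (a : Piece 𝓑) : ℝ≥0∞ :=
  ENNReal.ofReal (Q a.1.2 a.1.1)

/-- The weight `p^Y Q_k(Y)` of a piece `(Y, k)`. -/
noncomputable def pieceWeight (p : ∀ i, PMF (V i)) (Q : Fin K → Finset (Σ i, V i) → ℝ)
    (a : Piece 𝓑) : ℝ≥0∞ :=
  hitWeight Q a * ∏ e ∈ a.1.1, p e.1 e.2

open Classical in
/-- The weight of a witness tree, given that the current configuration is `x`: the deepest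
occurrence of each variable is tested against `x`. -/
noncomputable def checkWeight (p : ∀ i, PMF (V i)) (Q : Fin K → Finset (Σ i, V i) → ℝ)
    (τ : Finset (Node 𝓑)) (x : ∀ i, V i) : ℝ≥0∞ :=
  ∏ a ∈ τ, (hitWeight Q a.1 *
    ∏ e ∈ a.1.1.1, if Top τ a e.1 then agree x e else p e.1 e.2)

lemma agree_eq [∀ i, DecidableEq (V i)] (x : ∀ i, V i) (e : Σ i, V i) :
    agree x e = if (⟨e.1, x e.1⟩ : Σ i, V i) = e then 1 else 0 := by
  classical
  obtain ⟨i, j⟩ := e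
  unfold agree
  congr 1
  simp

variable [∀ i, Fintype (V i)]

lemma sampleAll_apply (p : ∀ i, PMF (V i)) (z : ∀ i, V i) :
    sampleAll p z = ∏ i, p i (z i) := rfl

open Classical in
lemma sum_sampleAll_prod (p : ∀ i, PMF (V i)) (g : ∀ i, V i → ℝ≥0∞) :
    ∑ z, sampleAll p z * ∏ i, g i (z i) = ∏ i, ∑ j, p i j * g i j := by
  rw [Finset.prod_univ_sum, Fintype.piFinset_univ]
  refine Finset.sum_congr rfl fun z _ => ?_
  rw [sampleAll_apply, Finset.prod_mul_distrib]

lemma sum_pmf {α : Type*} [Fintype α] (p : PMF α) : ∑ a, p a = 1 := by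
  rw [← tsum_fintype (L := .unconditional _)]
  exact p.tsum_coe

open Classical in
/-- Independent variables: requirements on different variables hold with the product of their
probabilities. -/
lemma sum_sampleAll_agree {ι : Type*} (p : ∀ i, PMF (V i)) (S : Set (Fin n)) (x : ∀ i, V i)
    (T : Finset ι) (f : ι → Σ i, V i)
    (hf : ∀ s ∈ T, ∀ t ∈ T, (f s).1 = (f t).1 → s = t) :
    ∑ z, sampleAll p z * ∏ t ∈ T, agree (mix S z x) (f t) =
      ∏ t ∈ T, if (f t).1 ∈ S then p (f t).1 (f t).2 else agree x (f t) := by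
  have h1 : ∀ y : ∀ i, V i, ∏ t ∈ T, agree y (f t) =
      ∏ i, ∏ t ∈ T with (f t).1 = i, if (⟨i, y i⟩ : Σ i, V i) = f t then 1 else 0 := by
    intro y
    rw [← Finset.prod_fiberwise T (fun t => (f t).1)]
    refine Finset.prod_congr rfl fun i _ => Finset.prod_congr rfl fun t ht => ?_
    rw [Finset.mem_filter] at ht
    obtain ⟨-, rfl⟩ := ht
    rw [agree_eq]
  simp_rw [h1]
  have h2 := sum_sampleAll_prod p (fun i j => ∏ t ∈ T with (f t).1 = i,
    if (⟨i, if i ∈ S then j else x i⟩ : Σ i, V i) = f t then (1 : ℝ≥0∞) else 0)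
  refine Eq.trans h2 ?_
  rw [← Finset.prod_fiberwise T (fun t => (f t).1)]
  refine Finset.prod_congr rfl fun i _ => ?_
  by_cases he : (T.filter fun t => (f t).1 = i) = ∅
  · rw [he]
    simp [sum_pmf]
  · obtain ⟨t, ht⟩ := Finset.nonempty_iff_ne_empty.2 he
    have hs : (T.filter fun t => (f t).1 = i) = {t} := by
      ext s
      rw [Finset.mem_singleton]
      rw [Finset.mem_filter] at ht ⊢
      exact ⟨fun h => hf s h.1 t ht.1 (h.2.trans ht.2.symm), fun h => h ▸ ht⟩
    rw [hs]
    simp only [Finset.prod_singleton]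
    rw [Finset.mem_filter] at ht
    obtain ⟨-, rfl⟩ := ht
    by_cases hS : (f t).1 ∈ S
    · simp only [hS, if_true]
      rw [Finset.sum_eq_single (f t).2]
      · simp
      · intro j _ hj
        rw [if_neg, mul_zero]
        intro h
        apply hj
        have : ∀ (e : Σ i, V i) (j : V e.1), (⟨e.1, j⟩ : Σ i, V i) = e → j = e.2 := by
          rintro ⟨a, b⟩ j h
          simpa using h
        exact this _ _ h
      · simp
    · simp only [hS, if_false]
      rw [← Finset.sum_mul, sum_pmf, one_mul, agree_eq]

-- Two top nodes that involve the same variable have equal depth and overlap, so they coincide;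
-- pieces are atomic as well. The tests therefore concern distinct variables, and the expectation
-- factors.
open Classical in
lemma sum_sampleAll_checkWeight (p : ∀ i, PMF (V i)) (Q : Fin K → Finset (Σ i, V i) → ℝ)
    {τ : Finset (Node 𝓑)} (hτ : IsWitness τ) (S : Set (Fin n)) (x : ∀ i, V i) :
    ∑ z, sampleAll p z * checkWeight p Q τ (mix S z x) =
      ∏ a ∈ τ, (hitWeight Q a.1 * ∏ e ∈ a.1.1.1,
        if Top τ a e.1 then (if e.1 ∈ S then p e.1 e.2 else agree x e) else p e.1 e.2) := by
  have h1 : ∀ F : (Σ i, V i) → ℝ≥0∞, ∏ a ∈ τ, (hitWeight Q a.1 * ∏ e ∈ a.1.1.1,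
        if Top τ a e.1 then F e else p e.1 e.2) =
      ((∏ a ∈ τ, hitWeight Q a.1) * ∏ t ∈ τ.sigma (fun a => a.1.1.1) with ¬ Top τ t.1 t.2.1,
        p t.2.1 t.2.2) * ∏ t ∈ τ.sigma (fun a => a.1.1.1) with Top τ t.1 t.2.1, F t.2 := by
    intro F
    rw [Finset.prod_mul_distrib, mul_assoc]
    congr 1
    rw [Finset.prod_sigma' τ (fun a => a.1.1.1)
      (fun a e => if Top τ a e.1 then F e else p e.1 e.2), Finset.prod_ite, mul_comm]
  unfold checkWeight
  rw [h1 fun e => if e.1 ∈ S then p e.1 e.2 else agree x e]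
  simp_rw [h1]
  rw [← sum_sampleAll_agree p S x _ (fun t : Σ _ : Node 𝓑, Σ i, V i => t.2), Finset.mul_sum]
  · exact Finset.sum_congr rfl fun z _ => mul_left_comm _ _ _
  · rintro ⟨a, e⟩ hs ⟨b, f⟩ ht (h : e.1 = f.1)
    simp only [Finset.mem_filter, Finset.mem_sigma] at hs ht
    obtain ⟨⟨ha, he⟩, h1⟩ := hs
    obtain ⟨⟨hb, hf⟩, h2⟩ := ht
    have hab : a = b := hτ.indep a ha b hb
      (le_antisymm (h2 a ha ⟨e, he, h⟩) (h1 b hb ⟨f, hf, h.symm⟩)) ⟨e, he, f, hf, h⟩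
    subst hab
    rw [a.1.atomic e he f hf h]

/-- Under a fresh sample, the expected weight of a witness tree is the product of the weights of
its nodes. -/
lemma sum_sampleAll_checkWeight_univ (p : ∀ i, PMF (V i)) (Q : Fin K → Finset (Σ i, V i) → ℝ)
    {τ : Finset (Node 𝓑)} (hτ : IsWitness τ) :
    ∑ z, sampleAll p z * checkWeight p Q τ z = ∏ a ∈ τ, pieceWeight p Q a.1 := by
  have x : ∀ i, V i := fun i => (p i).support_nonempty.some
  have h := sum_sampleAll_checkWeight p Q hτ Set.univ x
  have hm : ∀ z : ∀ i, V i, mix Set.univ z x = z := fun z => by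
    funext i
    simp [mix]
  simpa [hm, pieceWeight] using h

/-- A resampling that is not recorded in the tree does not change its weight. -/
lemma sum_sampleAll_checkWeight_skip (p : ∀ i, PMF (V i)) (Q : Fin K → Finset (Σ i, V i) → ℝ)
    {τ : Finset (Node 𝓑)} (hτ : IsWitness τ) {e : Piece 𝓑} (h : ∀ a ∈ τ, ¬ Eligible τ e a)
    (x : ∀ i, V i) :
    ∑ z, sampleAll p z * checkWeight p Q τ (mix (vars e.1.1) z x) = checkWeight p Q τ x := by
  classical
  rw [sum_sampleAll_checkWeight p Q hτ]
  refine Finset.prod_congr rfl fun a ha => ?_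
  congr 1
  refine Finset.prod_congr rfl fun f hf => ?_
  rw [if_neg (c := f.1 ∈ vars e.1.1)]
  rintro ⟨g, hg, hgf⟩
  exact h a ha (Or.inl ⟨g, hg, f, hf, hgf⟩)

/-- A resampling that is recorded in the tree. -/
lemma sum_sampleAll_checkWeight_added (p : ∀ i, PMF (V i))
    (Q : Fin K → Finset (Σ i, V i) → ℝ) {τ τ₁ : Finset (Node 𝓑)} (hτ : IsWitness τ)
    {e : Piece 𝓑} {u : List (Piece 𝓑)} (h : Added e u τ τ₁) (x : ∀ i, V i)
    (hx : Holds e.1.1 x) :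
    hitWeight Q e * ∑ z, sampleAll p z * checkWeight p Q τ (mix (vars e.1.1) z x) =
      checkWeight p Q τ₁ x := by
  classical
  have hins : τ₁ = insert (e, u) τ := by
    ext a
    rw [h.mem_iff, Finset.mem_insert]
  have hdeep : ∀ a ∈ τ, ∀ i ∈ vars e.1.1, i ∈ vars a.1.1.1 → a.2.length < u.length := by
    rintro a ha i ⟨f, hf, hfi⟩ ⟨g, hg, hgi⟩
    exact h.deep a ha (Or.inl ⟨f, hf, g, hg, hfi.trans hgi.symm⟩)
  rw [sum_sampleAll_checkWeight p Q hτ]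
  conv_rhs => rw [checkWeight, hins, Finset.prod_insert h.not_mem, ← hins]
  congr 1
  -- Nodes sharing a variable with `e` are strictly higher, so every occurrence in the new node is
  -- tested against `x`, and `hx` makes the test succeed.
  · have : ∏ f ∈ e.1.1, (if Top τ₁ (e, u) f.1 then agree x f else p f.1 f.2) = 1 := by
      refine Finset.prod_eq_one fun f hf => ?_
      rw [if_pos, agree, if_pos (hx f hf)]
      intro b hb hfb
      rcases (h.mem_iff b).1 hb with rfl | hb
      · exact le_rfl
      · exact (hdeep b hb f.1 ⟨f, hf, rfl⟩ hfb).le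
    rw [this, mul_one]
  · refine Finset.prod_congr rfl fun a ha => ?_
    congr 1
    refine Finset.prod_congr rfl fun f hf => ?_
    -- For a resampled variable, a test in `τ` averages to its probability; in `τ₁` this occurrence
    -- lies above the new node and carries the same probability.
    by_cases hv : f.1 ∈ vars e.1.1
    · rw [if_pos hv, ite_self, if_neg]
      intro ht
      have h1 := ht (e, u) ((h.mem_iff _).2 (Or.inl rfl)) hv
      have h2 := hdeep a ha f.1 hv ⟨f, hf, rfl⟩
      simp only at h1
      omega
    · rw [if_neg hv]
      have : Top τ a f.1 ↔ Top τ₁ a f.1 := by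
        constructor
        · intro ht b hb hfb
          rcases (h.mem_iff b).1 hb with rfl | hb
          · exact absurd hfb hv
          · exact ht b hb hfb
        · exact fun ht b hb => ht b ((h.mem_iff b).2 (Or.inr hb))
      simp only [this]

end Check

/-! ### Expectations under discrete distributions -/

section Expectation

variable {α β : Type*}

lemma tsum_pmf_bind (p : PMF α) (f : α → PMF β) (g : β → ℝ≥0∞) :
    ∑' b, p.bind f b * g b = ∑' a, p a * ∑' b, f a b * g b := by
  simp_rw [PMF.bind_apply, ← ENNReal.tsum_mul_right, ← ENNReal.tsum_mul_left]
  rw [ENNReal.tsum_comm]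
  simp_rw [mul_assoc]

lemma tsum_pmf_pure (a : α) (g : α → ℝ≥0∞) : ∑' b, PMF.pure a b * g b = g a := by
  classical
  rw [tsum_eq_single a]
  · simp
  · intro b hb
    simp [PMF.pure_apply, hb]

lemma tsum_pmf_map (p : PMF α) (f : α → β) (g : β → ℝ≥0∞) :
    ∑' b, p.map f b * g b = ∑' a, p a * g (f a) := by
  rw [PMF.map, tsum_pmf_bind]
  simp_rw [Function.comp_apply, tsum_pmf_pure]

lemma tsum_pmf_mul_le (p : PMF α) {g : α → ℝ≥0∞} {c : ℝ≥0∞} (h : ∀ a, p a ≠ 0 → g a ≤ c) :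
    ∑' a, p a * g a ≤ c := by
  calc ∑' a, p a * g a ≤ ∑' a, p a * c := by
        refine ENNReal.tsum_le_tsum fun a => ?_
        by_cases ha : p a = 0
        · simp [ha]
        · exact mul_le_mul_right (h a ha) _
    _ = c := by rw [ENNReal.tsum_mul_right, p.tsum_coe, one_mul]

end Expectation

/-! ### One round of the algorithm -/

section OneRound

variable {n K : ℕ} {V : Fin n → Type*} {𝓑 : BadEvents V K}

/-- The type of witness trees. -/
abbrev Witness (𝓑 : BadEvents V K) : Type _ := {τ : Finset (Node 𝓑) // IsWitness τ}

/-- `succ` on the type of witness trees. -/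
noncomputable def Witness.succ (e : Piece 𝓑) (τ : Witness 𝓑) : Witness 𝓑 :=
  ⟨PartialResampling.succ e τ.1, isWitness_succ τ.2 e⟩

variable (𝓑) in
/-- The empty witness tree. -/
def Witness.empty : Witness 𝓑 := ⟨∅, isWitness_empty⟩

/-- The piece resampled by the algorithm in a bad event `B`. -/
def pieceOf (B : {B // B ∈ 𝓑.events}) (Y : Finset (Σ i, V i)) (h : Y ⊆ B.1) : Piece 𝓑 :=
  ⟨(Y, 𝓑.label B), B.1, ⟨B.2, rfl⟩, h⟩

open Classical in
variable (𝓑) in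
/-- The piece that was resampled in a round, if any. -/
noncomputable def Record.piece (r : Record V) : Option (Piece 𝓑) :=
  match r.resampling with
  | none => none
  | some (B, Y) => if h : ∃ _ : B ∈ 𝓑.events, Y ⊆ B then some (pieceOf ⟨B, h.1⟩ Y h.2) else none

open Classical in
/-- The sum of `F` over all trees that become `τ` when the piece `o` is taken into account. -/
noncomputable def pull (τ : Witness 𝓑) (o : Option (Piece 𝓑)) (F : Witness 𝓑 → ℝ≥0∞) : ℝ≥0∞ :=
  match o with
  | none => F τ
  | some e => ∑' τ' : Witness 𝓑, if τ'.succ e = τ then F τ' else 0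

variable [∀ i, Fintype (V i)]

lemma tsum_resample (p : ∀ i, PMF (V i)) (Y : Finset (Σ i, V i)) (x : ∀ i, V i)
    (g : (∀ i, V i) → ℝ≥0∞) :
    ∑' y, resample p Y x y * g y = ∑ z, sampleAll p z * g (mix (vars Y) z x) := by
  unfold resample
  rw [tsum_pmf_map, tsum_fintype]
  refine Finset.sum_congr rfl fun z _ => ?_
  congr 2
  funext i
  simp only [mix, vars, Set.mem_ofPred_eq]
  congr

lemma selectSubset_ne_zero {Q : Fin K → Finset (Σ i, V i) → ℝ}
    {hQ : ∀ k, IsFractionalHittingSet (Q k) (𝓑.family k)} {B : {B // B ∈ 𝓑.events}}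
    {Y : Finset (Σ i, V i)} (h : selectSubset 𝓑 Q hQ B Y ≠ 0) : Y ⊆ B.1 := by
  by_contra hY
  apply h
  simp [selectSubset, PMF.normalize_apply, hY]

/-- The hitting set condition says that the normalising sum is at least 1. -/
lemma selectSubset_le {Q : Fin K → Finset (Σ i, V i) → ℝ}
    (hQ : ∀ k, IsFractionalHittingSet (Q k) (𝓑.family k)) (B : {B // B ∈ 𝓑.events})
    (Y : Finset (Σ i, V i)) :
    selectSubset 𝓑 Q hQ B Y ≤ ENNReal.ofReal (Q (𝓑.label B) Y) := by
  classical
  unfold selectSubset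
  rw [PMF.normalize_apply]
  have h1 : (1 : ℝ≥0∞) ≤ ∑' Y, if Y ⊆ B.1 then ENNReal.ofReal (Q (𝓑.label B) Y) else 0 := by
    rw [tsum_fintype, ← Finset.sum_filter]
    have h2 : (Finset.univ.filter fun Y => Y ⊆ B.1) = B.1.powerset := by
      ext Y
      simp
    rw [h2, ← ENNReal.ofReal_sum_of_nonneg fun Y _ => ((hQ (𝓑.label B)).1 Y).1]
    rw [← ENNReal.ofReal_one]
    exact ENNReal.ofReal_le_ofReal ((hQ (𝓑.label B)).2 B.1 ⟨B.2, rfl⟩)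
  calc _ ≤ ENNReal.ofReal (Q (𝓑.label B) Y) * 1 := by
        gcongr
        · split_ifs <;> simp
        · exact ENNReal.inv_le_one.2 h1
    _ = _ := mul_one _

-- If `τ` arises by an addition from a subset of `B`, a single term survives, and its factor Q is
-- the one contributed by the new node. Otherwise every contributing piece is skipped, and the sum
-- is an average of terms at most `checkWeight p Q τ.1 x`.
open Classical in
lemma tsum_selectSubset_le (p : ∀ i, PMF (V i)) {Q : Fin K → Finset (Σ i, V i) → ℝ}
    (hQ : ∀ k, IsFractionalHittingSet (Q k) (𝓑.family k)) (B : {B // B ∈ 𝓑.events})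
    {x : ∀ i, V i} (hB : Holds B.1 x) (τ : Witness 𝓑) :
    ∑' Y, selectSubset 𝓑 Q hQ B Y * (if h : Y ⊆ B.1 then ∑' τ' : Witness 𝓑,
      if τ'.succ (pieceOf B Y h) = τ then
        ∑ z, sampleAll p z * checkWeight p Q τ'.1 (mix (vars Y) z x) else 0 else 0) ≤
      checkWeight p Q τ.1 x := by
  by_cases hadd : ∃ Y₀, ∃ h₀ : Y₀ ⊆ B.1, ∃ τ₀ : Witness 𝓑, τ₀.succ (pieceOf B Y₀ h₀) = τ ∧
      ∃ u, Added (pieceOf B Y₀ h₀) u τ₀.1 τ.1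
  · obtain ⟨Y₀, h₀, τ₀, hs, u, hu⟩ := hadd
    have huniq : ∀ Y (h : Y ⊆ B.1) (τ' : Witness 𝓑), τ'.succ (pieceOf B Y h) = τ →
        Y = Y₀ ∧ τ' = τ₀ := by
      intro Y h τ' h'
      obtain ⟨h1, h2⟩ := hu.unique τ'.2 (congrArg Subtype.val h') rfl
        ⟨B.1, ⟨B.2, rfl⟩, h, h₀⟩
      exact ⟨congrArg (fun a : Piece 𝓑 => a.1.1) h1, Subtype.ext h2⟩
    rw [tsum_eq_single Y₀, dif_pos h₀, tsum_eq_single τ₀, if_pos hs]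
    · rw [← sum_sampleAll_checkWeight_added p Q τ₀.2 hu x fun e he => hB e (h₀ he)]
      exact mul_le_mul_left (selectSubset_le hQ B Y₀) _
    · intro τ' hτ'
      exact if_neg fun h => hτ' (huniq _ _ _ h).2
    · intro Y hY
      split_ifs with h
      · rw [ENNReal.tsum_eq_zero.2, mul_zero]
        intro τ'
        exact if_neg fun h' => hY (huniq _ _ _ h').1
      · exact mul_zero _
  · refine tsum_pmf_mul_le _ fun Y _ => ?_
    split_ifs with h
    · have hskip : ∀ τ' : Witness 𝓑, τ'.succ (pieceOf B Y h) = τ →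
          τ' = τ ∧ ∀ a ∈ τ.1, ¬ Eligible τ.1 (pieceOf B Y h) a := by
        intro τ' h'
        rcases succ_cases τ'.2 (pieceOf B Y h) with ⟨u, hu⟩ | ⟨h1, h2⟩
        · rw [show PartialResampling.succ (pieceOf B Y h) τ'.1 = τ.1 from
            congrArg Subtype.val h'] at hu
          exact absurd ⟨Y, h, τ', h', u, hu⟩ hadd
        · have h3 : τ' = τ := by
            rw [← h']
            exact Subtype.ext h1.symm
          exact ⟨h3, h3 ▸ h2⟩
      rw [tsum_eq_single τ]
      · split_ifs with h'
        · exact (sum_sampleAll_checkWeight_skip p Q τ.2 (hskip τ h').2 x).le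
        · exact zero_le
      · intro τ' hτ'
        exact if_neg fun h' => hτ' (hskip τ' h').1
    · exact zero_le

/-- In one round, the expected weight of the trees that become `τ` does not exceed the weight
of `τ`. -/
lemma tsum_round_le (p : ∀ i, PMF (V i)) {Q : Fin K → Finset (Σ i, V i) → ℝ}
    (hQ : ∀ k, IsFractionalHittingSet (Q k) (𝓑.family k)) (σ : Strategy 𝓑) {t : ℕ}
    (h : History V t) (τ : Witness 𝓑) :
    ∑' r, PartialResampling.round 𝓑 p Q hQ σ h r *
        pull τ (r.piece 𝓑) (fun τ' => checkWeight p Q τ'.1 r.config) ≤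
      checkWeight p Q τ.1 h.current := by
  classical
  unfold PartialResampling.round
  split_ifs with hB
  · rw [tsum_pmf_bind]
    refine tsum_pmf_mul_le _ fun B _ => ?_
    rw [tsum_pmf_bind]
    refine le_trans (ENNReal.tsum_le_tsum fun Y => ?_) (tsum_selectSubset_le p hQ B.1 B.2 τ)
    by_cases h0 : selectSubset 𝓑 Q hQ B.1 Y = 0
    · simp [h0]
    have hY : Y ⊆ B.1.1 := selectSubset_ne_zero h0
    rw [dif_pos hY, tsum_pmf_map, tsum_resample]
    refine mul_le_mul_right (le_of_eq ?_) _
    have hp : ∀ y : ∀ i, V i, Record.piece 𝓑 ⟨y, some (B.1.1, Y)⟩ = some (pieceOf B.1 Y hY) := by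
      intro y
      exact dif_pos ⟨B.1.2, hY⟩
    simp_rw [hp, pull, ← ENNReal.tsum_mul_left]
    rw [← tsum_fintype (L := .unconditional _), ENNReal.tsum_comm]
    refine tsum_congr fun τ' => ?_
    rw [tsum_fintype]
    split_ifs
    · rfl
    · simp
  · rw [tsum_pmf_pure]
    exact le_rfl

end OneRound

/-! ### Counting the occurrences of a tree in a log -/

section Counting

variable {n K : ℕ} {V : Fin n → Type*} {𝓑 : BadEvents V K}

open Classical in
/-- The indicator that `τ'` becomes `τ` when the piece `o` is taken into account. -/
noncomputable def link (τ : Witness 𝓑) (o : Option (Piece 𝓑)) (τ' : Witness 𝓑) : ℝ≥0∞ :=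
  match o with
  | none => if τ' = τ then 1 else 0
  | some e => if τ'.succ e = τ then 1 else 0

lemma pull_eq_tsum (τ : Witness 𝓑) (o : Option (Piece 𝓑)) (F : Witness 𝓑 → ℝ≥0∞) :
    pull τ o F = ∑' τ', link τ o τ' * F τ' := by
  classical
  cases o with
  | none =>
    rw [tsum_eq_single τ]
    · simp [pull, link]
    · intro τ' h
      simp [link, h]
  | some e => simp [pull, link]

open Classical in
/-- The number of those final segments of a log whose witness tree is `τ`. The final segments that
begin with a resampling are counted, and one empty segment for each resampling and for the end. -/
noncomputable def count : List (Option (Piece 𝓑)) → Witness 𝓑 → ℝ≥0∞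
  | [], τ => if τ = Witness.empty 𝓑 then 1 else 0
  | none :: L, τ => count L τ
  | some e :: L, τ => (if τ = Witness.empty 𝓑 then 1 else 0) + pull τ (some e) (count L)

lemma Witness.succ_ne_empty (e : Piece 𝓑) (τ : Witness 𝓑) : τ.succ e ≠ Witness.empty 𝓑 :=
  fun h => PartialResampling.succ_ne_empty e τ.1 (congrArg Subtype.val h)

/-- A tree produced by `succ` is nonempty, so only the empty segment contributes. -/
lemma count_empty (L : List (Option (Piece 𝓑))) : count L (Witness.empty 𝓑) = 1 := by
  induction L with
  | nil => simp [count]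
  | cons o L ih =>
    cases o with
    | none => simpa [count] using ih
    | some e => simp [count, pull, Witness.succ_ne_empty]

lemma count_cons {τ : Witness 𝓑} (hτ : τ ≠ Witness.empty 𝓑) (o : Option (Piece 𝓑))
    (L : List (Option (Piece 𝓑))) : count (o :: L) τ = pull τ o (count L) := by
  cases o with
  | none => rfl
  | some e => simp [count, hτ]

/-- Every resampling is counted by exactly one witness tree. -/
lemma tsum_count (L : List (Option (Piece 𝓑))) :
    ∑' τ, count L τ = 1 + (L.map fun o => if o.isSome then (1 : ℝ≥0∞) else 0).sum := by
  classical
  induction L with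
  | nil => simp [count]
  | cons o L ih =>
    cases o with
    | none => simpa [count] using ih
    | some e =>
      simp only [count, pull, List.map_cons, List.sum_cons, Option.isSome_some, if_true]
      rw [ENNReal.tsum_add, tsum_ite_eq, ENNReal.tsum_comm, ← ih]
      congr 1
      exact tsum_congr fun τ' => by simp

variable (𝓑) in
/-- The pieces resampled in the rounds `t + 1, …, t + N`. -/
noncomputable def log (ω : ℕ → Record V) : ℕ → ℕ → List (Option (Piece 𝓑))
  | _, 0 => []
  | t, N + 1 => (ω (t + 1)).piece 𝓑 :: log ω (t + 1) N

lemma log_map_sum (ω : ℕ → Record V) (g : Option (Piece 𝓑) → ℝ≥0∞) (t N : ℕ) :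
    ((log 𝓑 ω t N).map g).sum = ∑ s ∈ Finset.range N, g ((ω (t + 1 + s)).piece 𝓑) := by
  induction N generalizing t with
  | zero => simp [log]
  | succ N ih =>
    rw [log, List.map_cons, List.sum_cons, ih, Finset.sum_range_succ', add_comm]
    congr 1
    exact Finset.sum_congr rfl fun s _ => by rw [show t + 1 + 1 + s = t + 1 + (s + 1) by ring]

end Counting

/-! ### Expected number of resamplings and termination -/

section Run

variable {n K : ℕ} {V : Fin n → Type*} {𝓑 : BadEvents V K} [∀ i, Fintype (V i)]

lemma measurable_log (t N : ℕ) : Measurable[_, ⊤] fun ω : ℕ → Record V => log 𝓑 ω t N := by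
  let _ : MeasurableSpace (List (Option (Piece 𝓑))) := ⊤
  have : DiscreteMeasurableSpace (List (Option (Piece 𝓑))) := ⟨fun _ => trivial⟩
  induction N generalizing t with
  | zero => exact measurable_const
  | succ N ih =>
    have h1 : Measurable fun q : Record V × List (Option (Piece 𝓑)) => q.1.piece 𝓑 :: q.2 :=
      .of_discrete
    exact h1.comp ((measurable_pi_apply (t + 1)).prodMk (ih (t + 1)))

lemma measurable_comp_log (F : List (Option (Piece 𝓑)) → ℝ≥0∞) (t N : ℕ) :
    Measurable fun ω : ℕ → Record V => F (log 𝓑 ω t N) := by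
  let _ : MeasurableSpace (List (Option (Piece 𝓑))) := ⊤
  have hF : Measurable F := measurable_from_top
  exact hF.comp (measurable_log t N)

variable (p : ∀ i, PMF (V i)) {Q : Fin K → Finset (Σ i, V i) → ℝ}
  (hQ : ∀ k, IsFractionalHittingSet (Q k) (𝓑.family k)) (σ : Strategy 𝓑)

lemma lintegral_pmf {α : Type*} [MeasurableSpace α] [DiscreteMeasurableSpace α] [Countable α]
    (q : PMF α) (f : α → ℝ≥0∞) : ∫⁻ a, f a ∂q.toMeasure = ∑' a, q a * f a := by
  rw [lintegral_countable']
  exact tsum_congr fun a => by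
    rw [q.toMeasure_apply_singleton a (measurableSet_singleton a), mul_comm]

instance : IsProbabilityMeasure (runLaw 𝓑 p Q hQ σ) :=
  inferInstanceAs (IsProbabilityMeasure (Kernel.trajMeasure _ _))

/-- The law of the next record, given the history. -/
lemma lintegral_runLaw_succ (t : ℕ) (F : History V t → Record V → ℝ≥0∞) :
    ∫⁻ ω, F (Preorder.frestrictLe t ω) (ω (t + 1)) ∂runLaw 𝓑 p Q hQ σ =
      ∫⁻ ω, ∑' r, PartialResampling.round 𝓑 p Q hQ σ (Preorder.frestrictLe t ω) r *
        F (Preorder.frestrictLe t ω) r ∂runLaw 𝓑 p Q hQ σ := by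
  have hm : Measurable (Function.uncurry F) := .of_discrete
  have h1 := Kernel.map_frestrictLe_trajMeasure_compProd_eq_map_trajMeasure
    (X := fun _ => Record V) (μ₀ := initialLaw p) (κ := roundKernel 𝓑 p Q hQ σ) (a := t)
  have h2 := congrArg (fun m => ∫⁻ z, Function.uncurry F z ∂m) h1
  rw [Measure.lintegral_compProd hm, lintegral_map .of_discrete (by fun_prop),
    lintegral_map hm (by fun_prop)] at h2
  refine h2.symm.trans (lintegral_congr fun ω => ?_)
  exact lintegral_pmf _ _

/-- The law of the initial record. -/
lemma lintegral_runLaw_zero (F : Record V → ℝ≥0∞) :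
    ∫⁻ ω, F (ω 0) ∂runLaw 𝓑 p Q hQ σ = ∑ x, sampleAll p x * F ⟨x, none⟩ := by
  have hm : Measurable F := .of_discrete
  have h1 : (runLaw 𝓑 p Q hQ σ).map (Preorder.frestrictLe 0) =
      (initialLaw p).map (MeasurableEquiv.piUnique (fun _ : Finset.Iic 0 => Record V)).symm := by
    unfold runLaw Kernel.trajMeasure
    rw [Measure.map_comp _ _ (by fun_prop), Kernel.traj_map_frestrictLe, Kernel.partialTraj_self,
      Measure.id_comp]
  have h2 : ∫⁻ ω, F (ω 0) ∂runLaw 𝓑 p Q hQ σ =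
      ∫⁻ h : History V 0, F (h ⟨0, Finset.mem_Iic.2 le_rfl⟩)
        ∂(runLaw 𝓑 p Q hQ σ).map (Preorder.frestrictLe 0) := by
    rw [lintegral_map .of_discrete (by fun_prop)]
    rfl
  rw [h2, h1, lintegral_map .of_discrete (by fun_prop)]
  refine Eq.trans (b := ∫⁻ r, F r ∂initialLaw p) rfl ?_
  rw [initialLaw, lintegral_pmf, tsum_pmf_map, tsum_fintype]

/-- The expected number of occurrences of a witness tree after time `t`, conditional on the history
up to time `t`, is at most its weight. -/
lemma lintegral_count_le (τ : Witness 𝓑) (N t : ℕ) (ψ : History V t → ℝ≥0∞) :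
    ∫⁻ ω, ψ (Preorder.frestrictLe t ω) * count (log 𝓑 ω t N) τ ∂runLaw 𝓑 p Q hQ σ ≤
      ∫⁻ ω, ψ (Preorder.frestrictLe t ω) * checkWeight p Q τ.1 (ω t).config
        ∂runLaw 𝓑 p Q hQ σ := by
  classical
  induction N generalizing t τ with
  | zero =>
    refine lintegral_mono fun ω => mul_le_mul_right ?_ _
    rw [log, count]
    split_ifs with h
    · subst h
      simp [Witness.empty, checkWeight]
    · exact zero_le
  | succ N ih =>
    by_cases hτ : τ = Witness.empty 𝓑
    · subst hτ
      simp only [count_empty]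
      simp [Witness.empty, checkWeight]
    have hmeas : ∀ (t : ℕ) (g : History V t → ℝ≥0∞),
        Measurable fun ω : ℕ → Record V => g (Preorder.frestrictLe t ω) := fun t g =>
      (Measurable.of_discrete (f := g)).comp (by fun_prop)
    -- Whether round `t + 1` turns `τ'` into `τ` is determined by the history up to `t + 1`, so this
    -- indicator joins the test function. The arbitrary `ψ` is what lets the induction absorb it.
    let φ (τ' : Witness 𝓑) (h : History V (t + 1)) : ℝ≥0∞ :=
      ψ (Preorder.frestrictLe₂ (π := fun _ => Record V) (Nat.le_succ t) h) *
        link τ ((h ⟨t + 1, Finset.mem_Iic.2 le_rfl⟩).piece 𝓑) τ'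
    calc ∫⁻ ω, ψ (Preorder.frestrictLe t ω) * count (log 𝓑 ω t (N + 1)) τ ∂runLaw 𝓑 p Q hQ σ
        = ∫⁻ ω, ∑' τ', φ τ' (Preorder.frestrictLe (t + 1) ω) * count (log 𝓑 ω (t + 1) N) τ'
            ∂runLaw 𝓑 p Q hQ σ := by
          refine lintegral_congr fun ω => ?_
          rw [log, count_cons hτ, pull_eq_tsum, ← ENNReal.tsum_mul_left]
          refine tsum_congr fun τ' => ?_
          rw [← mul_assoc]
          rfl
      _ = ∑' τ', ∫⁻ ω, φ τ' (Preorder.frestrictLe (t + 1) ω) * count (log 𝓑 ω (t + 1) N) τ'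
            ∂runLaw 𝓑 p Q hQ σ :=
          lintegral_tsum fun τ' => ((hmeas (t + 1) (φ τ')).mul
            (measurable_comp_log (fun L => count L τ') _ _)).aemeasurable
      _ ≤ ∑' τ', ∫⁻ ω, φ τ' (Preorder.frestrictLe (t + 1) ω) *
            checkWeight p Q τ'.1 (ω (t + 1)).config ∂runLaw 𝓑 p Q hQ σ :=
          ENNReal.tsum_le_tsum fun τ' => ih τ' (t + 1) (φ τ')
      _ = ∫⁻ ω, ∑' τ', φ τ' (Preorder.frestrictLe (t + 1) ω) *
            checkWeight p Q τ'.1 (ω (t + 1)).config ∂runLaw 𝓑 p Q hQ σ :=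
          (lintegral_tsum fun τ' => (hmeas (t + 1) fun h => φ τ' h *
            checkWeight p Q τ'.1 h.current).aemeasurable).symm
      _ = ∫⁻ ω, ψ (Preorder.frestrictLe t ω) * pull τ ((ω (t + 1)).piece 𝓑)
            (fun τ' => checkWeight p Q τ'.1 (ω (t + 1)).config) ∂runLaw 𝓑 p Q hQ σ := by
          refine lintegral_congr fun ω => ?_
          rw [pull_eq_tsum, ← ENNReal.tsum_mul_left]
          refine tsum_congr fun τ' => ?_
          rw [← mul_assoc]
          rfl
      _ = ∫⁻ ω, ∑' r, PartialResampling.round 𝓑 p Q hQ σ (Preorder.frestrictLe t ω) r *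
            (ψ (Preorder.frestrictLe t ω) * pull τ (r.piece 𝓑)
              (fun τ' => checkWeight p Q τ'.1 r.config)) ∂runLaw 𝓑 p Q hQ σ :=
          lintegral_runLaw_succ p hQ σ t fun h r => ψ h * pull τ (r.piece 𝓑)
            (fun τ' => checkWeight p Q τ'.1 r.config)
      _ ≤ _ := by
          refine lintegral_mono fun ω => ?_
          simp_rw [mul_left_comm _ (ψ _), ENNReal.tsum_mul_left]
          exact mul_le_mul_right (tsum_round_le p hQ σ _ τ) _

/-- The expected number of resamplings is at most the total weight of all witness trees. -/
lemma lintegral_sum_range_le (N : ℕ) :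
    1 + ∫⁻ ω, ∑ s ∈ Finset.range N, (if ((ω (s + 1)).piece 𝓑).isSome then (1 : ℝ≥0∞) else 0)
        ∂runLaw 𝓑 p Q hQ σ ≤
      ∑' τ : Witness 𝓑, ∏ a ∈ τ.1, pieceWeight p Q a.1 := by
  calc _ = ∫⁻ ω, ∑' τ, count (log 𝓑 ω 0 N) τ ∂runLaw 𝓑 p Q hQ σ := by
        simp_rw [tsum_count, log_map_sum, zero_add]
        rw [lintegral_add_left measurable_const]
        simp [add_comm 1]
    _ = ∑' τ, ∫⁻ ω, count (log 𝓑 ω 0 N) τ ∂runLaw 𝓑 p Q hQ σ :=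
        lintegral_tsum fun τ => (measurable_comp_log (fun L => count L τ) _ _).aemeasurable
    _ ≤ _ := by
        refine ENNReal.tsum_le_tsum fun τ => ?_
        have h := lintegral_count_le p hQ σ τ N 0 fun _ => 1
        simp only [one_mul] at h
        refine h.trans (le_of_eq ?_)
        rw [lintegral_runLaw_zero p hQ σ fun r => checkWeight p Q τ.1 r.config,
          sum_sampleAll_checkWeight_univ p Q τ.2]

/-- Properties of the possible outcomes of a round. -/
lemma round_ne_zero {t : ℕ} {h : History V t} {r : Record V}
    (hr : PartialResampling.round 𝓑 p Q hQ σ h r ≠ 0) :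
    (r.resampling.isSome → (r.piece 𝓑).isSome) ∧
      (r.resampling = none → (∀ B ∈ 𝓑.events, ¬ Holds B h.current) ∧ r.config = h.current) := by
  rw [← PMF.mem_support_iff] at hr
  unfold PartialResampling.round at hr
  split_ifs at hr with hB
  · simp only [PMF.mem_support_bind_iff, PMF.mem_support_map_iff] at hr
    obtain ⟨B, -, Y, hY, x, -, rfl⟩ := hr
    refine ⟨fun _ => ?_, by simp⟩
    have : Record.piece 𝓑 ⟨x, some (B.1.1, Y)⟩ =
        some (pieceOf B.1 Y (selectSubset_ne_zero ((PMF.mem_support_iff _ _).1 hY))) :=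
      dif_pos ⟨B.1.2, selectSubset_ne_zero ((PMF.mem_support_iff _ _).1 hY)⟩
    rw [this]
    rfl
  · rw [PMF.mem_support_pure_iff] at hr
    subst hr
    exact ⟨by simp, fun _ => ⟨fun B hB1 hB2 => hB ⟨⟨⟨B, hB1⟩, hB2⟩⟩, rfl⟩⟩

lemma ae_round : ∀ᵐ ω ∂runLaw 𝓑 p Q hQ σ, ∀ t,
    ((ω (t + 1)).resampling.isSome → ((ω (t + 1)).piece 𝓑).isSome) ∧
      ((ω (t + 1)).resampling = none →
        (∀ B ∈ 𝓑.events, ¬ Holds B (ω t).config) ∧ (ω (t + 1)).config = (ω t).config) := by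
  classical
  rw [ae_all_iff]
  intro t
  let A (h : History V t) (r : Record V) : Prop :=
    (r.resampling.isSome → (r.piece 𝓑).isSome) ∧
      (r.resampling = none → (∀ B ∈ 𝓑.events, ¬ Holds B h.current) ∧ r.config = h.current)
  have h1 := lintegral_runLaw_succ p hQ σ t fun h r => if A h r then 0 else 1
  have h2 : ∀ h : History V t, ∑' r, PartialResampling.round 𝓑 p Q hQ σ h r *
      (if A h r then (0 : ℝ≥0∞) else 1) = 0 := by
    intro h
    rw [ENNReal.tsum_eq_zero]
    intro r
    by_cases hr : PartialResampling.round 𝓑 p Q hQ σ h r = 0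
    · simp [hr]
    · rw [if_pos (round_ne_zero p hQ σ hr), mul_zero]
  simp_rw [h2, lintegral_zero] at h1
  have hm : Measurable fun ω : ℕ → Record V =>
      (if A (Preorder.frestrictLe t ω) (ω (t + 1)) then (0 : ℝ≥0∞) else 1) :=
    (Measurable.of_discrete (f := fun q : History V t × Record V =>
      if A q.1 q.2 then (0 : ℝ≥0∞) else 1)).comp
      (g := fun q : History V t × Record V => if A q.1 q.2 then (0 : ℝ≥0∞) else 1)
      (f := fun ω : ℕ → Record V => (Preorder.frestrictLe t ω, ω (t + 1))) (by fun_prop)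
  rw [lintegral_eq_zero_iff hm] at h1
  filter_upwards [h1] with ω hω
  by_contra hA
  have : ¬ A (Preorder.frestrictLe t ω) (ω (t + 1)) := hA
  simp [this] at hω

lemma ae_initial : ∀ᵐ ω ∂runLaw 𝓑 p Q hQ σ, (ω 0).resampling = none := by
  classical
  have h1 := lintegral_runLaw_zero p hQ σ fun r => if r.resampling = none then 0 else 1
  simp only [if_true, mul_zero, Finset.sum_const_zero] at h1
  have hm : Measurable fun ω : ℕ → Record V =>
      (if (ω 0).resampling = none then (0 : ℝ≥0∞) else 1) :=
    (Measurable.of_discrete (f := fun r : Record V =>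
      if r.resampling = none then (0 : ℝ≥0∞) else 1)).comp (by fun_prop)
  rw [lintegral_eq_zero_iff hm] at h1
  filter_upwards [h1] with ω hω
  by_contra hA
  simp [hA] at hω

/-- The initial record contains no resampling, so starting at index 1 loses nothing; monotone
convergence passes from `N` rounds to the whole run. -/
lemma lintegral_numResamplings_le :
    1 + ∫⁻ ω, numResamplings ω ∂runLaw 𝓑 p Q hQ σ ≤
      ∑' τ : Witness 𝓑, ∏ a ∈ τ.1, pieceWeight p Q a.1 := by
  have h1 : ∫⁻ ω, numResamplings ω ∂runLaw 𝓑 p Q hQ σ ≤ ∫⁻ ω, ∑' s,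
      (if ((ω (s + 1)).piece 𝓑).isSome then (1 : ℝ≥0∞) else 0) ∂runLaw 𝓑 p Q hQ σ := by
    refine lintegral_mono_ae ?_
    filter_upwards [ae_round p hQ σ, ae_initial p hQ σ] with ω hω h0
    unfold numResamplings
    rw [tsum_eq_zero_add' ENNReal.summable, h0]
    simp only [Option.isSome_none, Bool.false_eq_true, if_false, zero_add]
    refine ENNReal.tsum_le_tsum fun s => ?_
    split_ifs with h2 h3
    · exact le_rfl
    · exact absurd ((hω s).1 h2) h3
    · exact zero_le
    · exact le_rfl
  have hm : ∀ s, Measurable fun ω : ℕ → Record V =>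
      (if ((ω (s + 1)).piece 𝓑).isSome then (1 : ℝ≥0∞) else 0) := fun s =>
    (Measurable.of_discrete (f := fun r : Record V =>
      if (r.piece 𝓑).isSome then (1 : ℝ≥0∞) else 0)).comp (measurable_pi_apply _)
  refine (add_le_add_right h1 1).trans ?_
  rw [lintegral_tsum fun s => (hm s).aemeasurable, ENNReal.tsum_eq_iSup_nat, ENNReal.add_iSup]
  refine iSup_le fun N => ?_
  rw [← lintegral_finsetSum _ fun s _ => hm s]
  exact lintegral_sum_range_le p hQ σ N

/-- A finite expected number of resamplings implies termination. -/
lemma ae_terminatesFeasibly (h : ∫⁻ ω, numResamplings ω ∂runLaw 𝓑 p Q hQ σ ≠ ∞) :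
    ∀ᵐ ω ∂runLaw 𝓑 p Q hQ σ, TerminatesFeasibly 𝓑 ω := by
  have hm : Measurable (numResamplings (V := V)) := .tsum fun t => (Measurable.of_discrete (f := fun r : Record V =>
    if r.resampling.isSome then (1 : ℝ≥0∞) else 0)).comp (measurable_pi_apply t)
  filter_upwards [ae_lt_top hm h, ae_round p hQ σ] with ω hω hr
  have h1 := ENNReal.tendsto_atTop_zero_of_tsum_ne_top (f := fun t => if (ω t).resampling.isSome
    then (1 : ℝ≥0∞) else 0) hω.ne
  -- The terms are 0 or 1, so terms below 1 vanish.
  have h2 := h1.eventually_lt_const (u := 1) one_pos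
  rw [Filter.eventually_atTop] at h2
  obtain ⟨t, ht⟩ := h2
  have hnone : ∀ s, t ≤ s → (ω s).resampling = none := by
    intro s hs
    by_contra hc
    have := ht s hs
    rw [← ne_eq, ← Option.isSome_iff_ne_none] at hc
    simp [hc] at this
  refine ⟨(ω t).config, ((hr t).2 (hnone (t + 1) (by omega))).1, t, fun s hs =>
    ⟨?_, hnone _ (by omega)⟩⟩
  induction s, hs using Nat.le_induction with
  | base => rfl
  | succ s hs ih => exact ((hr s).2 (hnone _ (by omega))).2.trans ih

end Run

/-! ### Total weight of all witness trees -/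

section TotalWeight

variable {n K : ℕ} {V : Fin n → Type*} {𝓑 : BadEvents V K}

open Classical in
/-- The labels of the children of the node `a`. -/
noncomputable def children (τ : Finset (Node 𝓑)) (a : Node 𝓑) : Finset (Piece 𝓑) :=
  (τ.filter fun b => b.2 = a.1 :: a.2).image Prod.fst

lemma mem_children {τ : Finset (Node 𝓑)} {a : Node 𝓑} {c : Piece 𝓑} :
    c ∈ children τ a ↔ (c, a.1 :: a.2) ∈ τ := by
  classical
  simp only [children, Finset.mem_image, Finset.mem_filter]
  constructor
  · rintro ⟨⟨b, u⟩, ⟨h1, h2⟩, rfl⟩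
    simp only at h2
    exact h2 ▸ h1
  · exact fun h => ⟨_, ⟨h, rfl⟩, rfl⟩

/-- The nodes of depth less than `h`. -/
def lower (h : ℕ) (τ : Finset (Node 𝓑)) : Finset (Node 𝓑) := τ.filter fun a => a.2.length < h

/-- The nodes of depth `h`. -/
def level (h : ℕ) (τ : Finset (Node 𝓑)) : Finset (Node 𝓑) := τ.filter fun a => a.2.length = h

lemma isWitness_lower (h : ℕ) {τ : Finset (Node 𝓑)} (hτ : IsWitness τ) :
    IsWitness (lower h τ) := by
  have hs : lower h τ ⊆ τ := Finset.filter_subset _ _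
  refine ⟨fun e f u he => ?_, fun e f he hf => hτ.root e f (hs he) (hs hf),
    fun a ha b hb => hτ.indep a (hs ha) b (hs hb), fun e f u he => hτ.related e f u (hs he),
    fun e e' f u he he' => hτ.side e e' f u (hs he) (hs he')⟩
  have h1 := hτ.closed e f u (hs he)
  simp only [lower, Finset.mem_filter, List.length_cons] at he ⊢
  exact ⟨h1, by omega⟩

lemma isNeighborSet_children {τ : Finset (Node 𝓑)} (hτ : IsWitness τ) (a : Node 𝓑) :
    IsNeighborSet 𝓑 a.1.1 ((children τ a).map (Function.Embedding.subtype _)) := by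
  simp only [IsNeighborSet, Finset.forall_mem_map, Function.Embedding.coe_subtype]
  refine ⟨fun b hb => ?_, fun b hb c hc hbc ho => ?_, fun b hb c hc h1 h2 h3 h4 => ?_⟩
  · exact hτ.related _ _ _ (mem_children.1 hb)
  · have := hτ.indep _ (mem_children.1 hb) _ (mem_children.1 hc) rfl ho
    exact hbc (congrArg (fun z : Node 𝓑 => z.1.1) this)
  · rw [hτ.side _ _ _ _ (mem_children.1 hb) (mem_children.1 hc) ⟨h1, h3⟩ ⟨h2, h4⟩]

lemma prod_level_succ {τ : Finset (Node 𝓑)} (hτ : IsWitness τ) (h : ℕ) (m : Piece 𝓑 → ℝ≥0∞) :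
    ∏ b ∈ level (h + 1) τ, m b.1 = ∏ a ∈ level h τ, ∏ c ∈ children τ a, m c := by
  rw [Finset.prod_sigma']
  symm
  refine Finset.prod_nbij (fun t => (t.2, t.1.1 :: t.1.2)) ?_ ?_ ?_ fun _ _ => rfl
  · rintro ⟨a, c⟩ ht
    simp only [Finset.mem_sigma, level, Finset.mem_filter, mem_children] at ht ⊢
    exact ⟨ht.2, by simp [ht.1.2]⟩
  · rintro ⟨⟨a, u⟩, c⟩ - ⟨⟨a', u'⟩, c'⟩ - heq
    simp only [Prod.mk.injEq, List.cons.injEq] at heq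
    obtain ⟨rfl, rfl, rfl⟩ := heq
    rfl
  · rintro ⟨c, u⟩ hb
    simp only [level, Finset.coe_filter, Set.mem_ofPred_eq] at hb
    obtain ⟨hb, hl⟩ := hb
    cases u with
    | nil => simp at hl
    | cons f u =>
      refine ⟨⟨(f, u), c⟩, ?_, rfl⟩
      simp only [Finset.coe_sigma, Set.mem_sigma_iff, Finset.mem_coe, level, Finset.mem_filter,
        mem_children]
      exact ⟨⟨hτ.closed _ _ _ hb, by simpa using hl⟩, hb⟩

lemma level_lower_succ (h : ℕ) (τ : Finset (Node 𝓑)) :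
    level h (lower (h + 1) τ) = level h τ := by
  ext a
  simp only [level, lower, Finset.mem_filter]
  constructor
  · rintro ⟨⟨h1, -⟩, h2⟩
    exact ⟨h1, h2⟩
  · rintro ⟨h1, h2⟩
    exact ⟨⟨h1, by omega⟩, h2⟩

/-- A tree is determined by its lower part and the children of the last level of that part. -/
lemma subset_of_children_eq {h : ℕ} {τ τ' τ₀ : Finset (Node 𝓑)} (hτ : IsWitness τ)
    (hd : ∀ a ∈ τ, a.2.length ≤ h + 1) (h1 : lower (h + 1) τ = τ₀) (h2 : lower (h + 1) τ' = τ₀)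
    (heq : ∀ a ∈ level h τ₀, children τ a = children τ' a) : τ ⊆ τ' := by
  rintro ⟨c, u⟩ hb
  by_cases hl : u.length < h + 1
  · have : (c, u) ∈ lower (h + 1) τ := Finset.mem_filter.2 ⟨hb, hl⟩
    rw [h1, ← h2] at this
    exact (Finset.mem_filter.1 this).1
  · have hl' := hd _ hb
    cases u with
    | nil => simp at hl
    | cons f u =>
      simp only [List.length_cons] at hl hl'
      have hfu : (f, u) ∈ level h τ₀ := by
        rw [← h1, level_lower_succ]
        exact Finset.mem_filter.2 ⟨hτ.closed _ _ _ hb, by simp only; omega⟩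
      exact mem_children.1 (heq _ hfu ▸ mem_children.2 hb)

variable [∀ i, Fintype (V i)]

/-- The neighbor-sets for `a` that consist of pieces. -/
noncomputable def pieceNeighborSets (a : Piece 𝓑) : Finset (Finset (Piece 𝓑)) :=
  (Set.toFinite {T | IsNeighborSet 𝓑 a.1 (T.map (Function.Embedding.subtype _))}).toFinset

lemma mem_pieceNeighborSets {a : Piece 𝓑} {T : Finset (Piece 𝓑)} : T ∈ pieceNeighborSets a ↔
    IsNeighborSet 𝓑 a.1 (T.map (Function.Embedding.subtype _)) := by
  simp [pieceNeighborSets]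

open Classical in
/-- The weight of a tree of depth at most `h`, where leaves at depth `h` count with the
weight `m`, as if they carried all possible subtrees. -/
noncomputable def cutWeight (w m : Piece 𝓑 → ℝ≥0∞) (h : ℕ) (τ : Finset (Node 𝓑)) : ℝ≥0∞ :=
  if ∀ a ∈ τ, a.2.length ≤ h then (∏ a ∈ lower h τ, w a.1) * ∏ a ∈ level h τ, m a.1 else 0

/-- Extensions of `τ₀` by one level inject into independent choices of a neighbor-set at each node
of depth `h`. The choices need not be compatible between different parents, hence only an
inequality. -/
lemma sum_extensions_le (m : Piece 𝓑 → ℝ≥0∞) (h : ℕ) (τ₀ : Finset (Node 𝓑))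
    (F : Finset (Witness 𝓑)) (hd : ∀ τ ∈ F, ∀ a ∈ τ.1, a.2.length ≤ h + 1)
    (hF : ∀ τ ∈ F, lower (h + 1) τ.1 = τ₀) :
    ∑ τ ∈ F, ∏ a ∈ level (h + 1) τ.1, m a.1 ≤
      ∏ a ∈ level h τ₀, ∑ T ∈ pieceNeighborSets a.1, ∏ c ∈ T, m c := by
  classical
  let φ (τ : Witness 𝓑) (a : Node 𝓑) (_ : a ∈ level h τ₀) : Finset (Piece 𝓑) := children τ.1 a
  have hinj : Set.InjOn φ F := by
    intro τ hτ τ' hτ' heq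
    have heq' : ∀ a ∈ level h τ₀, children τ.1 a = children τ'.1 a := fun a ha =>
      congrFun (congrFun heq a) ha
    exact Subtype.ext (Finset.Subset.antisymm
      (subset_of_children_eq τ.2 (hd τ hτ) (hF τ hτ) (hF τ' hτ') heq')
      (subset_of_children_eq τ'.2 (hd τ' hτ') (hF τ' hτ') (hF τ hτ) fun a ha => (heq' a ha).symm))
  let g (ψ : ∀ a : Node 𝓑, a ∈ level h τ₀ → Finset (Piece 𝓑)) : ℝ≥0∞ :=
    ∏ x ∈ (level h τ₀).attach, ∏ c ∈ ψ x.1 x.2, m c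
  rw [Finset.prod_sum]
  calc ∑ τ ∈ F, ∏ a ∈ level (h + 1) τ.1, m a.1 = ∑ τ ∈ F, g (φ τ) := by
        refine Finset.sum_congr rfl fun τ hτ => ?_
        rw [prod_level_succ τ.2, ← level_lower_succ, hF τ hτ]
        exact (Finset.prod_attach _ fun a => ∏ c ∈ children τ.1 a, m c).symm
    _ = ∑ ψ ∈ F.image φ, g ψ := (Finset.sum_image hinj).symm
    _ ≤ _ := by
        refine Finset.sum_le_sum_of_subset fun ψ hψ => ?_
        obtain ⟨τ, -, rfl⟩ := Finset.mem_image.1 hψ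
        exact Finset.mem_pi.2 fun a _ =>
          mem_pieceNeighborSets.2 (isNeighborSet_children τ.2 a)

open Classical in
lemma tsum_extensions_le (m : Piece 𝓑 → ℝ≥0∞) (h : ℕ) (τ₀ : Finset (Node 𝓑)) :
    ∑' τ : Witness 𝓑, (if (∀ a ∈ τ.1, a.2.length ≤ h + 1) ∧ lower (h + 1) τ.1 = τ₀ then
      ∏ a ∈ level (h + 1) τ.1, m a.1 else 0) ≤
    ∏ a ∈ level h τ₀, ∑ T ∈ pieceNeighborSets a.1, ∏ c ∈ T, m c := by
  rw [ENNReal.tsum_eq_iSup_sum]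
  refine iSup_le fun F => ?_
  rw [← Finset.sum_filter]
  exact sum_extensions_le m h τ₀ _ (fun τ hτ => (Finset.mem_filter.1 hτ).2.1)
    fun τ hτ => (Finset.mem_filter.1 hτ).2.2

/-- Group the trees by their part `τ₀` of depth at most `h`. Summing out the last level leaves a
neighbor-set sum at each node of depth `h`, and `hm` bounds this sum times the node's `w` by its
`m`. -/
lemma tsum_cutWeight_succ_le {w m : Piece 𝓑 → ℝ≥0∞}
    (hm : ∀ a, w a * ∑ T ∈ pieceNeighborSets a, ∏ c ∈ T, m c ≤ m a) (h : ℕ) :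
    ∑' τ : Witness 𝓑, cutWeight w m (h + 1) τ.1 ≤ ∑' τ : Witness 𝓑, cutWeight w m h τ.1 := by
  classical
  calc ∑' τ : Witness 𝓑, cutWeight w m (h + 1) τ.1
      = ∑' τ : Witness 𝓑, ∑' τ₀ : Witness 𝓑,
          if (⟨lower (h + 1) τ.1, isWitness_lower _ τ.2⟩ : Witness 𝓑) = τ₀ then
            cutWeight w m (h + 1) τ.1 else 0 := by
        refine tsum_congr fun τ => ?_
        exact (tsum_ite_eq' _ fun _ => cutWeight w m (h + 1) τ.1).symm
    _ = ∑' τ₀ : Witness 𝓑, ∑' τ : Witness 𝓑,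
          if (⟨lower (h + 1) τ.1, isWitness_lower _ τ.2⟩ : Witness 𝓑) = τ₀ then
            cutWeight w m (h + 1) τ.1 else 0 := ENNReal.tsum_comm
    _ ≤ _ := by
        refine ENNReal.tsum_le_tsum fun τ₀ => ?_
        by_cases hd : ∀ a ∈ τ₀.1, a.2.length ≤ h
        · have hsplit : ∏ a ∈ τ₀.1, w a.1 =
              (∏ a ∈ lower h τ₀.1, w a.1) * ∏ a ∈ level h τ₀.1, w a.1 := by
            rw [← Finset.prod_filter_mul_prod_filter_not τ₀.1 fun a => a.2.length < h]
            congr 1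
            refine Finset.prod_congr (Finset.filter_congr fun a ha => ?_) fun _ _ => rfl
            have := hd a ha
            omega
          calc _ = ∑' τ : Witness 𝓑, (∏ a ∈ τ₀.1, w a.1) *
                (if (∀ a ∈ τ.1, a.2.length ≤ h + 1) ∧ lower (h + 1) τ.1 = τ₀.1 then
                  ∏ a ∈ level (h + 1) τ.1, m a.1 else 0) := by
                refine tsum_congr fun τ => ?_
                simp only [Subtype.ext_iff]
                by_cases h1 : lower (h + 1) τ.1 = τ₀.1
                · rw [if_pos h1, cutWeight]
                  split_ifs with h2 h3 h3
                  · rw [h1]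
                  · exact absurd ⟨h2, h1⟩ h3
                  · exact absurd h3.1 h2
                  · rw [mul_zero]
                · rw [if_neg h1, if_neg fun h => h1 h.2, mul_zero]
            _ ≤ (∏ a ∈ τ₀.1, w a.1) *
                ∏ a ∈ level h τ₀.1, ∑ T ∈ pieceNeighborSets a.1, ∏ c ∈ T, m c := by
                rw [ENNReal.tsum_mul_left]
                exact mul_le_mul_right (tsum_extensions_le m h τ₀.1) _
            _ ≤ _ := by
                rw [cutWeight, if_pos hd, hsplit, mul_assoc, ← Finset.prod_mul_distrib]
                exact mul_le_mul_right (Finset.prod_le_prod' fun a _ => hm a.1) _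
        -- No tree truncates to a `τ₀` that is too deep.
        · refine le_trans (le_of_eq ?_) zero_le
          refine ENNReal.tsum_eq_zero.2 fun τ => if_neg fun h1 => hd ?_
          rw [← h1]
          intro a ha
          exact Nat.lt_succ_iff.1 (Finset.mem_filter.1 ha).2

lemma tsum_cutWeight_zero_le (w m : Piece 𝓑 → ℝ≥0∞) :
    ∑' τ : Witness 𝓑, cutWeight w m 0 τ.1 ≤ 1 + ∑' a, m a := by
  classical
  have hb : ∀ τ : Witness 𝓑, cutWeight w m 0 τ.1 ≤ (if τ = Witness.empty 𝓑 then 1 else 0) +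
      ∑' a, if τ = (Witness.empty 𝓑).succ a then m a else 0 := by
    intro τ
    unfold cutWeight
    split_ifs with h1 h2 h2
    · subst h2
      simp [Witness.empty, lower, level]
    · have hne : τ.1.Nonempty := by
        rw [Finset.nonempty_iff_ne_empty]
        exact fun h => h2 (Subtype.ext h)
      obtain ⟨⟨r, u⟩, hr⟩ := hne
      have hu : u = [] := List.length_eq_zero_iff.1 (Nat.le_zero.1 (h1 _ hr))
      subst hu
      have hτ : τ.1 = {(r, [])} := by
        ext ⟨e, u⟩
        rw [Finset.mem_singleton]
        constructor
        · intro he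
          have hu : u = [] := List.length_eq_zero_iff.1 (Nat.le_zero.1 (h1 _ he))
          subst hu
          rw [τ.2.root _ _ he hr]
        · exact fun h => h ▸ hr
      have hs : τ = (Witness.empty 𝓑).succ r := Subtype.ext (by
        simp [hτ, Witness.succ, Witness.empty, succ])
      refine le_trans ?_ ((ENNReal.le_tsum r).trans le_add_self)
      rw [if_pos hs, hτ]
      simp [lower, level, Finset.filter_singleton]
    · exact zero_le
    · exact zero_le
  refine (ENNReal.tsum_le_tsum hb).trans ?_
  rw [ENNReal.tsum_add, tsum_ite_eq, ENNReal.tsum_comm]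
  gcongr with a
  rw [tsum_ite_eq]

/-- The total weight of all nonempty witness trees is at most the total of `m`. -/
lemma tsum_witness_le {w m : Piece 𝓑 → ℝ≥0∞}
    (hm : ∀ a, w a * ∑ T ∈ pieceNeighborSets a, ∏ c ∈ T, m c ≤ m a) :
    ∑' τ : Witness 𝓑, ∏ a ∈ τ.1, w a.1 ≤ 1 + ∑' a, m a := by
  classical
  have hcut : ∀ h, ∑' τ : Witness 𝓑, cutWeight w m h τ.1 ≤ 1 + ∑' a, m a := by
    intro h
    induction h with
    | zero => exact tsum_cutWeight_zero_le w m
    | succ h ih => exact (tsum_cutWeight_succ_le hm h).trans ih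
  rw [ENNReal.tsum_eq_iSup_sum]
  refine iSup_le fun F => ?_
  -- Below a cut deeper than all trees of `F`, the cut weight is the full product.
  obtain ⟨h, hh⟩ : ∃ h, ∀ τ ∈ F, ∀ a ∈ τ.1, a.2.length < h := by
    refine ⟨(F.sup fun τ => τ.1.sup fun a => a.2.length) + 1, fun τ hτ a ha => ?_⟩
    exact Nat.lt_succ_of_le ((Finset.le_sup (f := fun a : Node 𝓑 => a.2.length) ha).trans
      (Finset.le_sup (f := fun τ : Witness 𝓑 => τ.1.sup fun a => a.2.length) hτ))
  refine le_trans (Finset.sum_le_sum fun τ hτ => ?_) ((ENNReal.sum_le_tsum F).trans (hcut h))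
  rw [cutWeight, if_pos fun a ha => (hh τ hτ a ha).le, lower, level,
    Finset.filter_true_of_mem (hh τ hτ), Finset.filter_false_of_mem fun a ha => (hh τ hτ a ha).ne,
    Finset.prod_empty, mul_one]

end TotalWeight

/-! ### The three criteria -/

section Criteria

variable {n K : ℕ} {V : Fin n → Type*} {𝓑 : BadEvents V K}

lemma weight_nonneg (p : ∀ i, PMF (V i)) (Y : Finset (Σ i, V i)) : 0 ≤ weight p Y :=
  Finset.prod_nonneg fun _ _ => ENNReal.toReal_nonneg

lemma pieceWeight_eq (p : ∀ i, PMF (V i)) (Q : Fin K → Finset (Σ i, V i) → ℝ) (a : Piece 𝓑) :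
    pieceWeight p Q a = ENNReal.ofReal (weight p a.1.1 * Q a.1.2 a.1.1) := by
  rw [pieceWeight, hitWeight, mul_comm, ENNReal.ofReal_mul (weight_nonneg p _), weight,
    ENNReal.ofReal_prod_of_nonneg fun _ _ => ENNReal.toReal_nonneg]
  congr 1
  exact Finset.prod_congr rfl fun e _ => (ENNReal.ofReal_toReal (PMF.apply_ne_top _ _)).symm

variable [∀ i, Fintype (V i)]

lemma mem_neighborSets {a : Finset (Σ i, V i) × Fin K}
    {T : Finset (Finset (Σ i, V i) × Fin K)} :
    T ∈ neighborSets 𝓑 a ↔ IsNeighborSet 𝓑 a T := by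
  simp [neighborSets]

/-- Witness trees use only pieces; the further neighbor-sets on the right add nonnegative terms. -/
lemma sum_pieceNeighborSets_le {μ : Finset (Σ i, V i) → Fin K → ℝ} (hμ : ∀ Y k, 0 ≤ μ Y k)
    (a : Piece 𝓑) :
    ∑ T ∈ pieceNeighborSets a, ∏ c ∈ T, ENNReal.ofReal (μ c.1.1 c.1.2) ≤
      ENNReal.ofReal (∑ T ∈ neighborSets 𝓑 a.1, ∏ b ∈ T, μ b.1 b.2) := by
  classical
  rw [ENNReal.ofReal_sum_of_nonneg fun T _ => Finset.prod_nonneg fun b _ => hμ _ _]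
  calc _ = ∑ T ∈ (pieceNeighborSets a).map
        (Finset.mapEmbedding (Function.Embedding.subtype _)).toEmbedding,
        ENNReal.ofReal (∏ b ∈ T, μ b.1 b.2) := by
        rw [Finset.sum_map]
        refine Finset.sum_congr rfl fun T _ => ?_
        rw [ENNReal.ofReal_prod_of_nonneg fun b _ => hμ _ _]
        exact (Finset.prod_map T (Function.Embedding.subtype _)
          fun b : Finset (Σ i, V i) × Fin K => ENNReal.ofReal (μ b.1 b.2)).symm
    _ ≤ _ := by
        refine Finset.sum_le_sum_of_subset fun T hT => ?_
        obtain ⟨T', hT', rfl⟩ := Finset.mem_map.1 hT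
        exact mem_neighborSets.2 (mem_pieceNeighborSets.1 hT')

variable (p : ∀ i, PMF (V i)) {Q : Fin K → Finset (Σ i, V i) → ℝ}
  (hQ : ∀ k, IsFractionalHittingSet (Q k) (𝓑.family k))

/-- The criterion in terms of neighbor-sets. -/
lemma terminates_of_neighborSets {μ : Finset (Σ i, V i) → Fin K → ℝ} (hμ : ∀ Y k, 0 ≤ μ Y k)
    (h : ∀ Y k, weight p Y * Q k Y * ∑ T ∈ neighborSets 𝓑 (Y, k), ∏ b ∈ T, μ b.1 b.2 ≤ μ Y k)
    (σ : Strategy 𝓑) :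
    (∀ᵐ ω ∂(runLaw 𝓑 p Q hQ σ), TerminatesFeasibly 𝓑 ω) ∧
      ∫⁻ ω, numResamplings ω ∂(runLaw 𝓑 p Q hQ σ) ≤ ENNReal.ofReal (∑ Y, ∑ k, μ Y k) := by
  have h1 := (lintegral_numResamplings_le p hQ σ).trans
    (tsum_witness_le (𝓑 := 𝓑) (w := pieceWeight p Q)
      (m := fun a => ENNReal.ofReal (μ a.1.1 a.1.2)) fun a => by
        rw [pieceWeight_eq]
        refine (mul_le_mul_right (sum_pieceNeighborSets_le hμ a) _).trans ?_
        rw [← ENNReal.ofReal_mul (mul_nonneg (weight_nonneg p _) ((hQ _).1 _).1)]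
        exact ENNReal.ofReal_le_ofReal (h _ _))
  have h2 : ∫⁻ ω, numResamplings ω ∂(runLaw 𝓑 p Q hQ σ) ≤
      ENNReal.ofReal (∑ Y, ∑ k, μ Y k) := by
    -- The cancelled 1 is the empty tree.
    refine (ENNReal.add_le_add_iff_left ENNReal.one_ne_top).1 (h1.trans ?_)
    gcongr
    refine (ENNReal.tsum_comp_le_tsum_of_injective Subtype.val_injective
      fun a : Finset (Σ i, V i) × Fin K => ENNReal.ofReal (μ a.1 a.2)).trans ?_
    rw [tsum_fintype, Fintype.sum_prod_type,
      ENNReal.ofReal_sum_of_nonneg fun Y _ => Finset.sum_nonneg fun k _ => hμ Y k]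
    exact Finset.sum_le_sum fun Y _ => (ENNReal.ofReal_sum_of_nonneg fun k _ => hμ Y k).ge
  exact ⟨ae_terminatesFeasibly p hQ σ (ne_top_of_le_ne_top ENNReal.ofReal_ne_top h2), h2⟩

open Classical in
/-- The sum over all neighbor-sets is at most the product over their possible members. -/
lemma sum_neighborSets_le_prod {μ : Finset (Σ i, V i) → Fin K → ℝ} (hμ : ∀ Y k, 0 ≤ μ Y k)
    (a : Finset (Σ i, V i) × Fin K) (N : Finset (Finset (Σ i, V i) × Fin K))
    (hN : ∀ b, Related 𝓑 b a → μ b.1 b.2 ≠ 0 → b ∈ N) :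
    ∑ T ∈ neighborSets 𝓑 a, ∏ b ∈ T, μ b.1 b.2 ≤ ∏ b ∈ N, (1 + μ b.1 b.2) := by
  rw [Finset.prod_one_add,
    ← Finset.sum_filter_add_sum_filter_not (neighborSets 𝓑 a) fun T => T ⊆ N,
    Finset.sum_eq_zero (s := (neighborSets 𝓑 a).filter fun T => ¬ T ⊆ N), add_zero]
  · refine Finset.sum_le_sum_of_subset_of_nonneg (fun T hT => ?_)
      fun T _ _ => Finset.prod_nonneg fun b _ => hμ _ _
    exact Finset.mem_powerset.2 (Finset.mem_filter.1 hT).2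
  · intro T hT
    rw [Finset.mem_filter, mem_neighborSets, Finset.not_subset] at hT
    obtain ⟨hT, b, hb, hbN⟩ := hT
    refine Finset.prod_eq_zero hb ?_
    by_contra h
    exact hbN (hN b (hT.1 b hb) h)

/-- The symmetric criterion. -/
lemma terminates_of_degree {P : ℝ} {D : ℕ} (hP : ∀ Y k, weight p Y * Q k Y ≤ P)
    (hD : ∀ Y k, 0 < Q k Y → (supportedNeighbors 𝓑 Q (Y, k)).card ≤ D)
    (hPD : Real.exp 1 * P * D ≤ 1) (σ : Strategy 𝓑) :
    (∀ᵐ ω ∂(runLaw 𝓑 p Q hQ σ), TerminatesFeasibly 𝓑 ω) ∧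
      ∫⁻ ω, numResamplings ω ∂(runLaw 𝓑 p Q hQ σ) ≤
        ENNReal.ofReal (Real.exp 1 * ∑ Y, ∑ k, weight p Y * Q k Y) := by
  classical
  have h0 : ∀ Y k, 0 ≤ weight p Y * Q k Y := fun Y k =>
    mul_nonneg (weight_nonneg p Y) ((hQ k).1 Y).1
  have hμ : ∀ Y k, 0 ≤ Real.exp 1 * (weight p Y * Q k Y) := fun Y k =>
    mul_nonneg (Real.exp_pos _).le (h0 Y k)
  simp_rw [Finset.mul_sum]
  refine terminates_of_neighborSets p hQ hμ (fun Y k => ?_) σ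
  -- For an unsupported pair both sides vanish, so the degree bound is needed only for supported
  -- ones.
  rcases ((hQ k).1 Y).1.eq_or_lt with hq | hq
  · rw [← hq]
    simp
  rw [mul_comm]
  refine mul_le_mul_of_nonneg_right ?_ (h0 Y k)
  refine (sum_neighborSets_le_prod hμ (Y, k) (supportedNeighbors 𝓑 Q (Y, k))
    fun b hb hne => ?_).trans ?_
  · simp only [supportedNeighbors, Finset.mem_filter]
    refine ⟨Finset.mem_univ _, lt_of_le_of_ne ((hQ _).1 _).1 fun h => hne ?_, hb⟩
    rw [← h, mul_zero, mul_zero]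
  · have hP0 : 0 ≤ P := (h0 Y k).trans (hP Y k)
    calc ∏ b ∈ supportedNeighbors 𝓑 Q (Y, k), (1 + Real.exp 1 * (weight p b.1 * Q b.2 b.1))
        ≤ ∏ _b ∈ supportedNeighbors 𝓑 Q (Y, k), Real.exp (Real.exp 1 * P) := by
          refine Finset.prod_le_prod (fun b _ => add_nonneg one_pos.le (hμ _ _)) fun b _ => ?_
          rw [add_comm]
          refine (Real.add_one_le_exp _).trans (Real.exp_le_exp.2 ?_)
          exact mul_le_mul_of_nonneg_left (hP _ _) (Real.exp_pos _).le
      _ = Real.exp (Real.exp 1 * P * (supportedNeighbors 𝓑 Q (Y, k)).card) := by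
          rw [Finset.prod_const, ← Real.exp_nat_mul, mul_comm]
      _ ≤ Real.exp 1 := by
          refine Real.exp_le_exp.2 (le_trans ?_ hPD)
          have : 0 ≤ Real.exp 1 * P := mul_nonneg (Real.exp_pos _).le hP0
          exact mul_le_mul_of_nonneg_left (Nat.cast_le.2 (hD Y k hq)) this

/-- The sum over a family of functional relations is at most the product over the domain. -/
lemma sum_functional_le_prod {α β : Type*} [Fintype α] [Fintype β] (𝒜 : Finset (Finset (α × β)))
    (h𝒜 : ∀ A ∈ 𝒜, ∀ b ∈ A, ∀ c ∈ A, b.1 = c.1 → b = c) {μ : α × β → ℝ} (hμ : ∀ b, 0 ≤ μ b) :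
    ∑ A ∈ 𝒜, ∏ b ∈ A, μ b ≤ ∏ a, (1 + ∑ b, μ (a, b)) := by
  classical
  -- A functional relation is a map to `Option β`; `none`, with weight 1, marks points outside its
  -- domain.
  let g (a : α) (o : Option β) : ℝ := o.elim 1 fun b => μ (a, b)
  let φ (A : Finset (α × β)) (a : α) : Option β :=
    if h : ∃ b, (a, b) ∈ A then some h.choose else none
  have hφ : ∀ A ∈ 𝒜, ∀ a b, φ A a = some b ↔ (a, b) ∈ A := by
    intro A hA a b
    by_cases h : ∃ b, (a, b) ∈ A
    · simp only [φ, dif_pos h, Option.some.injEq]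
      constructor
      · exact fun hb => hb ▸ h.choose_spec
      · exact fun hb => congrArg Prod.snd (h𝒜 A hA _ h.choose_spec _ hb rfl)
    · simp only [φ, dif_neg h, reduceCtorEq, false_iff]
      exact fun hb => h ⟨b, hb⟩
  have hg : ∀ a o, 0 ≤ g a o := by
    rintro a (_ | b)
    · exact zero_le_one
    · exact hμ _
  have hprod : ∀ A ∈ 𝒜, ∏ b ∈ A, μ b = ∏ a, g a (φ A a) := by
    intro A hA
    rw [← Finset.prod_subset (Finset.subset_univ (A.image Prod.fst)),
      Finset.prod_image fun b hb c hc h => h𝒜 A hA b hb c hc h]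
    · refine Finset.prod_congr rfl fun b hb => ?_
      rw [(hφ A hA b.1 b.2).2 hb]
      rfl
    · intro a _ ha
      have : φ A a = none := by
        rw [Option.eq_none_iff_forall_ne_some]
        exact fun b hb => ha (Finset.mem_image.2 ⟨_, (hφ A hA a b).1 hb, rfl⟩)
      rw [this]
      rfl
  have hinj : Set.InjOn φ 𝒜 := by
    intro A hA A' hA' h
    ext ⟨a, b⟩
    rw [← hφ A hA, ← hφ A' hA', h]
  calc ∑ A ∈ 𝒜, ∏ b ∈ A, μ b = ∑ f ∈ 𝒜.image φ, ∏ a, g a (f a) := by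
        rw [Finset.sum_image hinj]
        exact Finset.sum_congr rfl hprod
    _ ≤ ∑ f : α → Option β, ∏ a, g a (f a) :=
        Finset.sum_le_sum_of_subset_of_nonneg (Finset.subset_univ _)
          fun f _ _ => Finset.prod_nonneg fun a _ => hg _ _
    _ = ∏ a, (1 + ∑ b, μ (a, b)) := by
        rw [← Fintype.piFinset_univ, ← Finset.prod_univ_sum]
        exact Finset.prod_congr rfl fun a _ => Fintype.sum_option _

/-- Split a neighbor-set into the members overlapping `Y` and the rest. The first part is
functional: two members with the same set would overlap each other. The second is empty or a single
⋈-member. The pair of parts determines the neighbor-set, so the sum is at most the product of the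
two sums. -/
lemma sum_neighborSets_le_overlapping_mul_bowtie {μ : Finset (Σ i, V i) → Fin K → ℝ}
    (hμ : ∀ Y k, 0 ≤ μ Y k) (Y : Finset (Σ i, V i)) (k : Fin K) :
    ∑ T ∈ neighborSets 𝓑 (Y, k), ∏ b ∈ T, μ b.1 b.2 ≤
      (∏ Z ∈ overlapping Y, (1 + ∑ l, μ Z l)) * (1 + ∑ Z ∈ bowtieSets 𝓑 k Y, μ Z k) := by
  classical
  let A (T : Finset (Finset (Σ i, V i) × Fin K)) := T.filter fun b => Overlap b.1 Y
  let C (T : Finset (Finset (Σ i, V i) × Fin K)) := T.filter fun b => ¬ Overlap b.1 Y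
  have hnn : ∀ T : Finset (Finset (Σ i, V i) × Fin K), 0 ≤ ∏ b ∈ T, μ b.1 b.2 := fun T =>
    Finset.prod_nonneg fun b _ => hμ _ _
  have hA : ∑ T ∈ (neighborSets 𝓑 (Y, k)).image A, ∏ b ∈ T, μ b.1 b.2 ≤
      ∏ Z ∈ overlapping Y, (1 + ∑ l, μ Z l) := by
    -- With zero weight off the overlapping sets, the product over all sets reduces to `overlapping
    -- Y`.
    let ν (b : Finset (Σ i, V i) × Fin K) : ℝ := if Overlap b.1 Y then μ b.1 b.2 else 0
    have h1 := sum_functional_le_prod ((neighborSets 𝓑 (Y, k)).image A) (μ := ν) (by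
      intro T hT b hb c hc hbc
      obtain ⟨T, hT', rfl⟩ := Finset.mem_image.1 hT
      rw [mem_neighborSets] at hT'
      obtain ⟨hb, hbo⟩ := Finset.mem_filter.1 hb
      obtain ⟨hc, -⟩ := Finset.mem_filter.1 hc
      by_contra hne
      exact hT'.2.1 b hb c hc hne (hbc ▸ hbo.self_left)) (fun b => by
      simp only [ν]
      split_ifs
      · exact hμ _ _
      · exact le_rfl)
    refine le_trans (le_of_eq ?_) (h1.trans (le_of_eq ?_))
    · refine Finset.sum_congr rfl fun T hT => ?_
      obtain ⟨T, -, rfl⟩ := Finset.mem_image.1 hT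
      exact Finset.prod_congr rfl fun b hb => (if_pos (Finset.mem_filter.1 hb).2).symm
    · rw [← Finset.prod_subset (Finset.subset_univ (overlapping Y))]
      · refine Finset.prod_congr rfl fun Z hZ => ?_
        simp only [ν, if_pos (Finset.mem_filter.1 hZ).2]
      · intro Z _ hZ
        have : ¬ Overlap Z Y := fun h => hZ (Finset.mem_filter.2 ⟨Finset.mem_univ _, h⟩)
        simp [ν, this]
  have hC : ∑ T ∈ (neighborSets 𝓑 (Y, k)).image C, ∏ b ∈ T, μ b.1 b.2 ≤
      1 + ∑ Z ∈ bowtieSets 𝓑 k Y, μ Z k := by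
    have hsub : (neighborSets 𝓑 (Y, k)).image C ⊆
        insert ∅ ((bowtieSets 𝓑 k Y).image fun Z => {(Z, k)}) := by
      intro S hS
      obtain ⟨T, hT, rfl⟩ := Finset.mem_image.1 hS
      rw [mem_neighborSets] at hT
      have hbow : ∀ b ∈ C T, b ∈ T ∧ b.2 = k ∧ Bowtie 𝓑 k b.1 Y := by
        intro b hb
        obtain ⟨hb, hbo⟩ := Finset.mem_filter.1 hb
        obtain ⟨h1, h2⟩ := (hT.1 b hb).resolve_left hbo
        rw [h1] at h2
        exact ⟨hb, h1, h2⟩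
      rw [Finset.mem_insert]
      refine (Finset.eq_empty_or_nonempty (C T)).imp_right ?_
      rintro ⟨⟨Z, l⟩, hb⟩
      obtain ⟨h1, rfl, h3⟩ := hbow _ hb
      refine Finset.mem_image.2 ⟨Z, Finset.mem_filter.2 ⟨Finset.mem_univ _, h3⟩, ?_⟩
      ext c
      rw [Finset.mem_singleton]
      constructor
      · exact fun hc => hc ▸ hb
      · intro hc
        obtain ⟨h4, h5, h6⟩ := hbow _ hc
        exact hT.2.2 c h4 _ h1 h5 rfl h6 h3
    refine (Finset.sum_le_sum_of_subset_of_nonneg hsub fun T _ _ => hnn T).trans ?_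
    rw [Finset.sum_insert (by simp), Finset.sum_image fun Z _ Z' _ h => by simpa using h]
    simp
  have hinj : Set.InjOn (fun T => (A T, C T)) (neighborSets 𝓑 (Y, k)) := by
    intro T _ T' _ h
    obtain ⟨h1, h2⟩ := Prod.mk.inj h
    rw [← Finset.filter_union_filter_not_eq (fun b => Overlap b.1 Y) T,
      ← Finset.filter_union_filter_not_eq (fun b => Overlap b.1 Y) T']
    exact congrArg₂ _ h1 h2
  calc ∑ T ∈ neighborSets 𝓑 (Y, k), ∏ b ∈ T, μ b.1 b.2
      = ∑ S ∈ (neighborSets 𝓑 (Y, k)).image fun T => (A T, C T),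
          (∏ b ∈ S.1, μ b.1 b.2) * ∏ b ∈ S.2, μ b.1 b.2 := by
        rw [Finset.sum_image hinj]
        exact Finset.sum_congr rfl fun T _ => (Finset.prod_filter_mul_prod_filter_not T _ _).symm
    _ ≤ ∑ S ∈ (neighborSets 𝓑 (Y, k)).image A ×ˢ (neighborSets 𝓑 (Y, k)).image C,
          (∏ b ∈ S.1, μ b.1 b.2) * ∏ b ∈ S.2, μ b.1 b.2 := by
        refine Finset.sum_le_sum_of_subset_of_nonneg (fun S hS => ?_)
          fun S _ _ => mul_nonneg (hnn _) (hnn _)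
        obtain ⟨T, hT, rfl⟩ := Finset.mem_image.1 hS
        exact Finset.mem_product.2
          ⟨Finset.mem_image_of_mem A hT, Finset.mem_image_of_mem C hT⟩
    _ = (∑ T ∈ (neighborSets 𝓑 (Y, k)).image A, ∏ b ∈ T, μ b.1 b.2) *
          ∑ T ∈ (neighborSets 𝓑 (Y, k)).image C, ∏ b ∈ T, μ b.1 b.2 := by
        rw [Finset.sum_product, Finset.sum_mul_sum]
    _ ≤ _ := mul_le_mul hA hC (Finset.sum_nonneg fun T _ => hnn T)
        (Finset.prod_nonneg fun Z _ => add_nonneg one_pos.le (Finset.sum_nonneg fun l _ => hμ _ _))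

/-- The asymmetric criterion. -/
lemma terminates_of_overlapping_mul_bowtie {μ : Finset (Σ i, V i) → Fin K → ℝ}
    (hμ : ∀ Y k, 0 ≤ μ Y k)
    (h : ∀ Y k, weight p Y * Q k Y * (∏ Z ∈ overlapping Y, (1 + ∑ l, μ Z l)) *
      (1 + ∑ Z ∈ bowtieSets 𝓑 k Y, μ Z k) ≤ μ Y k) (σ : Strategy 𝓑) :
    (∀ᵐ ω ∂(runLaw 𝓑 p Q hQ σ), TerminatesFeasibly 𝓑 ω) ∧
      ∫⁻ ω, numResamplings ω ∂(runLaw 𝓑 p Q hQ σ) ≤ ENNReal.ofReal (∑ Y, ∑ k, μ Y k) := by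
  refine terminates_of_neighborSets p hQ hμ (fun Y k => le_trans ?_ (h Y k)) σ
  rw [mul_assoc (weight p Y * Q k Y)]
  exact mul_le_mul_of_nonneg_left (sum_neighborSets_le_overlapping_mul_bowtie hμ Y k)
    (mul_nonneg (weight_nonneg p Y) ((hQ k).1 Y).1)

end Criteria

end PartialResampling

open PartialResampling in
theorem theorem2p5 {n K : ℕ} {V : Fin n → Type*} [∀ i, Fintype (V i)]
    (p : ∀ i, PMF (V i)) (𝓑 : BadEvents V K) (Q : Fin K → Finset (Σ i, V i) → ℝ)
    (hQ : ∀ k, IsFractionalHittingSet (Q k) (𝓑.family k)) :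
    -- (a)
    (∀ μ : Finset (Σ i, V i) → Fin K → ℝ, (∀ Y k, 0 ≤ μ Y k) →
      (∀ Y k, weight p Y * Q k Y * ∑ T ∈ neighborSets 𝓑 (Y, k), ∏ b ∈ T, μ b.1 b.2 ≤ μ Y k) →
      ∀ σ : Strategy 𝓑,
        (∀ᵐ ω ∂(runLaw 𝓑 p Q hQ σ), TerminatesFeasibly 𝓑 ω) ∧
        ∫⁻ ω, numResamplings ω ∂(runLaw 𝓑 p Q hQ σ) ≤ ENNReal.ofReal (∑ Y, ∑ k, μ Y k)) ∧
    -- (b)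
    (∀ μ : Finset (Σ i, V i) → Fin K → ℝ, (∀ Y k, 0 ≤ μ Y k) →
      (∀ Y k, weight p Y * Q k Y * (∏ Z ∈ overlapping Y, (1 + ∑ l, μ Z l)) *
          (1 + ∑ Z ∈ bowtieSets 𝓑 k Y, μ Z k) ≤ μ Y k) →
      ∀ σ : Strategy 𝓑,
        (∀ᵐ ω ∂(runLaw 𝓑 p Q hQ σ), TerminatesFeasibly 𝓑 ω) ∧
        ∫⁻ ω, numResamplings ω ∂(runLaw 𝓑 p Q hQ σ) ≤ ENNReal.ofReal (∑ Y, ∑ k, μ Y k)) ∧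
    -- (c)
    (∀ (P : ℝ) (D : ℕ), (∀ Y k, weight p Y * Q k Y ≤ P) →
      (∀ Y k, 0 < Q k Y → (supportedNeighbors 𝓑 Q (Y, k)).card ≤ D) →
      Real.exp 1 * P * D ≤ 1 →
      ∀ σ : Strategy 𝓑,
        (∀ᵐ ω ∂(runLaw 𝓑 p Q hQ σ), TerminatesFeasibly 𝓑 ω) ∧
        ∫⁻ ω, numResamplings ω ∂(runLaw 𝓑 p Q hQ σ) ≤
          ENNReal.ofReal (Real.exp 1 * ∑ Y, ∑ k, weight p Y * Q k Y)) := by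
  exact ⟨fun _ hμ h σ => terminates_of_neighborSets p hQ hμ h σ,
    fun _ hμ h σ => terminates_of_overlapping_mul_bowtie p hQ hμ h σ,
    fun _ _ hP hD hPD σ => terminates_of_degree p hQ hP hD hPD σ⟩
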